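/- Theorem (Effective density bound). Let $d>1$ be a squarefree integer, let $\Delta$ be the fundamental discriminant of $\mathbb{Q}(\sqrt d)$ ($\Delta=d$ if $d\equiv 1 \bmod 4$, $\Delta=4d$ otherwise), and let $\chi_d(n)=\left(\frac{\Delta}{n}\right)$ be the corresponding Kronecker symbol, with Dirichlet $L$-function $L(s,\chi_d)$. For $F=\zeta$ or $F=L(\cdot,\chi_d)$ consider the zeros $\rho=\beta+i\gamma$ of $F$ with $0<\beta<1$, $\gamma>0$, counted with multiplicity, with the weight $$w(\rho)=\frac{2(\beta(1-\beta)+\gamma^2)}{(\beta(1-\beta)+\gamma^2)^2+4\gamma^2(\tfrac12-\beta)^2}$$ (which is $2/(\tfrac14+\gamma^2)$ if $\beta=\tfrac12$). Put $$S_F(\delta)=\sum_{\rho}w(\rho)\cos(\gamma\delta),\qquad W_1(\zeta)=\sum_{\rho:\,\zeta(\rho)=0}w(\rho),\qquad N_d(\delta)=S_\zeta(\delta)^2-d\,S_L(\delta)^2 .$$ Let $\rho_1',\rho_2',\dots$ be these zeros of $L(s,\chi_d)$, repeated according to multiplicity and listed so that their ordinates $\gamma_1'\le\gamma_2'\le\cdots$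 are nondecreasing, and put $b_k=w(\rho_k')$, $$S_L^{(M)}(\delta)=\sum_{k=1}^M b_k\cos(\gamma_k'\delta),\qquad \epsilon_M=\sum_{k>M}b_k .$$ Let $M\ge 3$, and suppose that there is no nontrivial integer relation among $\gamma_1',\dots,\gamma_M'$: if $n_1,\dots,n_M\in\mathbb{Z}$ and $\sum_{k\le M} n_k\gamma_k'=0$, then all $n_k=0$. Then the series defining $W_1(\zeta)$ and $\epsilon_M$ converge; the function $S_L^{(M)}$ has a Ces\`aro distribution (the limiting law, as $T\to\infty$, of $S_L^{(M)}(\delta)$ with $\delta$ uniform in $[0,T]$), and this distribution has a bounded continuous probability density $f_{S_L^{(M)}}$ with $$\|f_{S_L^{(M)}}\|_\infty\le\frac1\pi\int_0^\infty\prod_{k=1}^M|J_0(b_kt)|\,dt<\infty,$$ where $J_0$ is the Bessel function of the first kind of order $0$; and $$\limsup_{T\to\infty}\frac1T\,\mathrm{meas}\{\delta\in[0,T]:N_d(\delta)>0\}\;\le\;2\,\|f_{S_L^{(M)}}\|_\infty\left(\frac{W_1(\zeta)}{\sqrt d}+\epsilon_M\right).$$ In particular, if the Ces\`aro density $\mathrm{dens}\{N_d>0\}=\lim_{T\to\infty}\frac1T\,\mathrm{meas}\{\delta\in[0,T]:N_d(\delta)>0\}$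 exists, it satisfies the same bound. -/

import Mathlib

open Filter Topology MeasureTheory BoundedContinuousFunction

/-! ### The quadratic character of a real quadratic field -/

/-- The Kronecker symbol `(a / n)` for `n ≥ 0`: completely multiplicative in `n ≥ 1`, equal to the
Jacobi symbol for odd `n`, with `(a / 2) = 0, 1, -1` according as `a` is even, `a ≡ ±1 mod 8`,
`a ≡ ±3 mod 8` (this is `ZMod.χ₈ a`); `(a / 0) = 1` if `a = ±1` and `0` otherwise. -/
def kroneckerSymbol (a : ℤ) (n : ℕ) : ℤ :=
  if n = 0 then (if a.natAbs = 1 then 1 else 0)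
  else ZMod.χ₈ (a : ZMod 8) ^ n.factorization 2 * jacobiSym a (n / 2 ^ n.factorization 2)

/-- The fundamental discriminant of `ℚ(√d)` (for squarefree `d > 1`). -/
def fundDisc (d : ℕ) : ℕ := if d % 4 = 1 then d else 4 * d

instance fundDisc_neZero (d : ℕ) [NeZero d] : NeZero (fundDisc d) :=
  ⟨by have := NeZero.ne d; unfold fundDisc; split_ifs <;> omega⟩

theorem kroneckerSymbol_of_odd (a : ℤ) {n : ℕ} (hn : Odd n) :
    kroneckerSymbol a n = jacobiSym a n := by
  have h2 : ¬ 2 ∣ n := fun h => by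
    rcases hn with ⟨k, hk⟩
    omega
  have h0 : n ≠ 0 := by rintro rfl; simp at h2
  simp [kroneckerSymbol, h0, Nat.factorization_eq_zero_of_not_dvd h2]

theorem kroneckerSymbol_of_mod_four_eq_one {d : ℕ} (hd : d % 4 = 1) (n : ℕ) :
    kroneckerSymbol (d : ℤ) n = jacobiSym (n : ℤ) d := by
  have hodd : Odd d := Nat.odd_iff.mpr (by omega)
  by_cases h0 : n = 0
  · subst h0
    by_cases h1 : d = 1
    · subst h1; simp [kroneckerSymbol]
    · have : 1 < d := by omega
      simp [kroneckerSymbol, h1, jacobiSym.zero_left this]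
  · have hm : Odd (n / 2 ^ n.factorization 2) := by
      have := Nat.not_dvd_ordCompl Nat.prime_two h0
      rw [Nat.odd_iff]; omega
    have hn : ((n : ℕ) : ℤ) = 2 ^ n.factorization 2 * ((n / 2 ^ n.factorization 2 : ℕ) : ℤ) := by
      exact_mod_cast (Nat.ordProj_mul_ordCompl_eq_self n 2).symm
    rw [kroneckerSymbol, if_neg h0]
    conv_rhs => rw [hn, jacobiSym.mul_left, jacobiSym.pow_left, jacobiSym.at_two hodd]
    rw [jacobiSym.quadratic_reciprocity_one_mod_four hd hm]
    simp

theorem kroneckerSymbol_four_mul (d : ℕ) (n : ℕ) :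
    kroneckerSymbol ((4 * d : ℕ) : ℤ) n = if n % 2 = 0 then 0 else jacobiSym (d : ℤ) n := by
  by_cases h : n % 2 = 0
  · rw [if_pos h]
    by_cases h0 : n = 0
    · subst h0
      rw [kroneckerSymbol, if_pos rfl, if_neg]
      rw [Int.natAbs_natCast]; omega
    · have hv : n.factorization 2 ≠ 0 :=
        (Nat.prime_two.factorization_pos_of_dvd h0 (Nat.dvd_of_mod_eq_zero h)).ne'
      have h8 : ZMod.χ₈ (((4 * d : ℕ) : ℤ) : ZMod 8) = 0 := by
        rw [ZMod.χ₈_int_eq_if_mod_eight, if_pos (by push_cast; omega)]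
      rw [kroneckerSymbol, if_neg h0, h8, zero_pow hv, zero_mul]
  · have hn : Odd n := Nat.odd_iff.mpr (by omega)
    rw [if_neg h, kroneckerSymbol_of_odd _ hn]
    push_cast
    rw [jacobiSym.mul_left, jacobiSym.at_four hn, one_mul]

theorem kroneckerSymbol_fundDisc_mod (d n : ℕ) :
    kroneckerSymbol (fundDisc d) (n % fundDisc d) = kroneckerSymbol (fundDisc d) n := by
  unfold fundDisc
  split_ifs with h
  · rw [kroneckerSymbol_of_mod_four_eq_one h, kroneckerSymbol_of_mod_four_eq_one h,
      jacobiSym.mod_left (n : ℤ)]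
    push_cast
    rfl
  · rw [kroneckerSymbol_four_mul, kroneckerSymbol_four_mul]
    have h2 : n % (4 * d) % 2 = n % 2 := Nat.mod_mod_of_dvd _ ⟨2 * d, by ring⟩
    rw [h2]
    split_ifs with h3
    · rfl
    · have hn : Odd n := Nat.odd_iff.mpr (by omega)
      rw [jacobiSym.mod_right (d : ℤ) hn, Int.natAbs_natCast]

theorem kroneckerSymbol_fundDisc_mul (d m n : ℕ) :
    kroneckerSymbol (fundDisc d) (m * n) =
      kroneckerSymbol (fundDisc d) m * kroneckerSymbol (fundDisc d) n := by
  unfold fundDisc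
  split_ifs with h
  · simp only [kroneckerSymbol_of_mod_four_eq_one h, Nat.cast_mul, jacobiSym.mul_left]
  · simp only [kroneckerSymbol_four_mul]
    rcases Nat.mod_two_eq_zero_or_one m with hm | hm
    · simp [hm, Nat.mul_mod]
    rcases Nat.mod_two_eq_zero_or_one n with hn | hn
    · simp [hn, Nat.mul_mod]
    · have hm0 : m ≠ 0 := by rintro rfl; simp at hm
      have hn0 : n ≠ 0 := by rintro rfl; simp at hn
      simp [hm, hn, Nat.mul_mod, jacobiSym.mul_right' _ hm0 hn0]

theorem kroneckerSymbol_fundDisc_of_not_coprime (d n : ℕ) [NeZero d]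
    (h : ¬ n.Coprime (fundDisc d)) : kroneckerSymbol (fundDisc d) n = 0 := by
  have hd0 : d ≠ 0 := NeZero.ne d
  unfold fundDisc at h ⊢
  split_ifs at h ⊢ with h4
  · rw [kroneckerSymbol_of_mod_four_eq_one h4, jacobiSym.eq_zero_iff]
    exact ⟨hd0, by simpa [Nat.Coprime] using h⟩
  · rw [kroneckerSymbol_four_mul]
    split_ifs with h2
    · rfl
    · rw [jacobiSym.eq_zero_iff]
      refine ⟨by rintro rfl; simp at h2, fun hc => h ?_⟩
      have hc' : Nat.Coprime d n := by simpa [Nat.Coprime] using hc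
      have h2n : Nat.Coprime n 2 := Nat.coprime_two_right.mpr
        (Nat.odd_iff.mpr (by omega))
      exact Nat.Coprime.mul_right (by simpa using Nat.Coprime.pow_right 2 h2n) hc'.symm

/-- The Dirichlet character `χ_d`, `n ↦ (Δ / n)`, where `Δ` is the fundamental discriminant of
`ℚ(√d)`. -/
noncomputable def quadChar (d : ℕ) [NeZero d] : DirichletCharacter ℂ (fundDisc d) where
  toFun a := (kroneckerSymbol (fundDisc d) a.val : ℂ)
  map_one' := by
    have h : kroneckerSymbol (fundDisc d) 1 = 1 := by
      rw [kroneckerSymbol_of_odd _ odd_one, jacobiSym.one_right]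
    rw [ZMod.val_one_eq_one_mod, kroneckerSymbol_fundDisc_mod, h, Int.cast_one]
  map_mul' a b := by
    rw [ZMod.val_mul, kroneckerSymbol_fundDisc_mod, kroneckerSymbol_fundDisc_mul, Int.cast_mul]
  map_nonunit' a ha := by
    rw [kroneckerSymbol_fundDisc_of_not_coprime, Int.cast_zero]
    intro h
    apply ha
    have := (ZMod.isUnit_iff_coprime a.val (fundDisc d)).mpr h
    rwa [ZMod.natCast_zmod_val] at this

theorem quadChar_natCast (d : ℕ) [NeZero d] (n : ℕ) :
    quadChar d (n : ZMod (fundDisc d)) = (kroneckerSymbol (fundDisc d) n : ℂ) := by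
  change ((kroneckerSymbol (fundDisc d) (n : ZMod (fundDisc d)).val : ℤ) : ℂ) = _
  rw [ZMod.val_natCast, kroneckerSymbol_fundDisc_mod]

/-- The quadratic Dirichlet `L`-function `s ↦ L(s, χ_d)` (analytically continued). -/
noncomputable def quadL (d : ℕ) [NeZero d] : ℂ → ℂ := (quadChar d).LFunction

/-! ### Zeros, Lorentzian weights and weighted zero sums -/

/-- The nontrivial zeros of `F` in the open upper half-plane. -/
def upperZeros (F : ℂ → ℂ) : Set ℂ := {ρ | F ρ = 0 ∧ 0 < ρ.re ∧ ρ.re < 1 ∧ 0 < ρ.im}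

/-- The Lorentzian weight of `ρ = β + iγ`; it is `2 / (1/4 + γ²)` when `β = 1/2`. -/
noncomputable def lorentzWeight (ρ : ℂ) : ℝ :=
  2 * (ρ.re * (1 - ρ.re) + ρ.im ^ 2) /
    ((ρ.re * (1 - ρ.re) + ρ.im ^ 2) ^ 2 + 4 * ρ.im ^ 2 * (1 / 2 - ρ.re) ^ 2)

/-- The weighted zero sum `S_F(δ) = ∑_ρ w(ρ) cos(γ δ)` over the zeros `ρ = β + iγ` of `F` in
`upperZeros F`, counted with multiplicity. -/
noncomputable def zeroSum (F : ℂ → ℂ) (δ : ℝ) : ℝ :=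
  ∑' ρ : upperZeros F, (analyticOrderNatAt F ρ : ℝ) * lorentzWeight ρ * Real.cos ((ρ : ℂ).im * δ)

/-- The total weight `W₁(F) = ∑_ρ w(ρ)`, with multiplicity. -/
noncomputable def totalWeight (F : ℂ → ℂ) : ℝ :=
  ∑' ρ : upperZeros F, (analyticOrderNatAt F ρ : ℝ) * lorentzWeight ρ

/-- The norm-form energy `N_d(δ) = S_ζ(δ)² - d S_L(δ)²`. -/
noncomputable def normFormEnergy (d : ℕ) [NeZero d] (δ : ℝ) : ℝ :=
  zeroSum riemannZeta δ ^ 2 - d * zeroSum (quadL d) δ ^ 2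

/-- `ρ 0, ρ 1, ρ 2, …` is the list of all zeros of `F` in `upperZeros F`, each repeated according to
its multiplicity, in the order of nondecreasing ordinates (zeros of equal ordinate may be listed in
any order). -/
structure IsZeroEnumeration (F : ℂ → ℂ) (ρ : ℕ → ℂ) : Prop where
  mem : ∀ k, ρ k ∈ upperZeros F
  mono : Monotone fun k => (ρ k).im
  count : ∀ z ∈ upperZeros F, {k | ρ k = z}.encard = analyticOrderAt F z

/-- The truncated sum `S^{(M)}(δ) = ∑_{k ≤ M} b_k cos(γ_k δ)` over the first `M` zeros. -/
noncomputable def truncSum (ρ : ℕ → ℂ) (M : ℕ) (δ : ℝ) : ℝ :=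
  ∑ k ∈ Finset.range M, lorentzWeight (ρ k) * Real.cos ((ρ k).im * δ)

/-- The tail `ε_M = ∑_{k > M} b_k`. -/
noncomputable def tailWeight (ρ : ℕ → ℂ) (M : ℕ) : ℝ := ∑' k : ℕ, lorentzWeight (ρ (M + k))

/-! ### Cesàro densities and distributions, and the Bessel function `J₀` -/

/-- The set `A` has Cesàro density `D`: `meas (A ∩ [0, T]) / T → D` as `T → ∞`. -/
def HasCesaroDensity (A : Set ℝ) (D : ℝ) : Prop :=
  Tendsto (fun T : ℝ => volume.real (A ∩ Set.Icc 0 T) / T) atTop (𝓝 D)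

/-- The upper Cesàro density `limsup_{T → ∞} meas (A ∩ [0, T]) / T`. -/
noncomputable def upperCesaroDensity (A : Set ℝ) : ℝ :=
  limsup (fun T : ℝ => volume.real (A ∩ Set.Icc 0 T) / T) atTop

/-- `f` is a probability density of the Cesàro (limiting) distribution of `S`: the values `S(δ)`,
`δ` uniform in `[0, T]`, converge in distribution to `f(x) dx` as `T → ∞`. -/
structure IsCesaroPDF (S : ℝ → ℝ) (f : ℝ → ℝ) : Prop where
  nonneg : ∀ x, 0 ≤ f x
  integrable : Integrable f
  integral_eq_one : ∫ x, f x = 1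
  tendsto : ∀ g : ℝ →ᵇ ℝ,
    Tendsto (fun T : ℝ => (∫ δ in (0 : ℝ)..T, g (S δ)) / T) atTop (𝓝 (∫ x, g x * f x))

/-- The Bessel function of the first kind of order `0`, by Bessel's integral. -/
noncomputable def besselJ0 (x : ℝ) : ℝ :=
  (1 / Real.pi) * ∫ θ in (0 : ℝ)..Real.pi, Real.cos (x * Real.sin θ)

/-! ### Densities from integrable characteristic functions -/

section FourierInversionOfMeasures

open Real FourierTransform

/-! If `N_d(δ) > 0`, then `√d |S_L(δ)| < |S_ζ(δ)| ≤ W₁(ζ)`, and truncating `S_L` costs at most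
`ε_M`. So the truncated sum lies in the window `[-η, η]` with `η = W₁(ζ)/√d + ε_M`, and a bounded
limiting density gives this window mass at most `2 ‖f‖ η`.

The density comes from Weyl equidistribution. Independence of the ordinates makes the phases `γ_k δ
/ 2π` equidistribute on the torus, so the limiting law is that of `∑ b_k cos(2πθ_k)` with
independent uniform `θ_k`. Its characteristic function is `∏ J₀(b_k t)`. Each factor is
`O(t^(-1/2))`, so three factors make it integrable, and Fourier inversion bounds the density
(`exists_isCesaroPDF_cosineSum`, `upperCesaroDensity_le_of_isCesaroPDF`).

Convergence of the weights needs zero counting. The completed L-function times `s(1 - s)` is entire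
and, being built from Mellin transforms of theta kernels, grows at most like `exp(K(1 +
|s|)^(3/2))`. Jensen's formula then allows `O(r^(3/2))` zeros within distance `r` of a point where
the function is nonzero, while the weights decay like `|ρ|^(-2)` (`summable_lorentzWeight`). This
covers `ζ`, as the case of modulus 1, and `L(s, χ_d)`, as `χ_d` is even. -/

theorem integral_cexp_gaussian_mul_charFun (μ : Measure ℝ) [IsProbabilityMeasure μ] {c : ℝ}
    (hc : 0 < c) (x : ℝ) :
    ∫ ξ : ℝ, Complex.exp (-c⁻¹ * ‖ξ‖ ^ 2) •
        (Complex.exp (↑(-2 * π * ξ * x) * Complex.I) • charFun μ (2 * π * ξ)) =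
      ((∫ y, √(π * c) * Real.exp (-(π ^ 2 * c) * (y - x) ^ 2) ∂μ : ℝ) : ℂ) := by
  have hint : Integrable (Function.uncurry fun (ξ y : ℝ) =>
      Complex.exp ((-(c⁻¹ : ℝ) : ℂ) * (ξ : ℂ) ^ 2 + (2 * π * (y - x) * Complex.I) * (ξ : ℂ) + 0))
      (volume.prod μ) := by
    have h1 : Integrable (fun ξ : ℝ => Real.exp (-c⁻¹ * ξ ^ 2)) :=
      integrable_exp_neg_mul_sq (by positivity)
    have h2 : Integrable (fun p : ℝ × ℝ => Real.exp (-c⁻¹ * p.1 ^ 2) * (1 : ℝ))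
        (volume.prod μ) := h1.mul_prod (integrable_const 1)
    refine h2.mono' (by fun_prop) (ae_of_all _ fun p => le_of_eq ?_)
    rw [Function.uncurry_def, Complex.norm_exp, mul_one]
    congr 1
    have : ((-(c⁻¹ : ℝ) : ℂ) * (p.1 : ℂ) ^ 2 + (2 * π * (p.2 - x) * Complex.I) * (p.1 : ℂ) + 0) =
      ((-c⁻¹ * p.1 ^ 2 : ℝ) : ℂ) + ((2 * π * (p.2 - x) * p.1 : ℝ) : ℂ) * Complex.I := by
      push_cast; ring
    rw [this, Complex.add_re, Complex.re_ofReal_mul, Complex.I_re, Complex.ofReal_re]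
    ring
  have h1 : ∀ ξ : ℝ, Complex.exp (-c⁻¹ * ‖ξ‖ ^ 2) •
        (Complex.exp (↑(-2 * π * ξ * x) * Complex.I) • charFun μ (2 * π * ξ)) =
      ∫ y, Complex.exp ((-(c⁻¹ : ℝ) : ℂ) * (ξ : ℂ) ^ 2 +
        (2 * π * (y - x) * Complex.I) * (ξ : ℂ) + 0) ∂μ := by
    intro ξ
    rw [charFun_apply_real, smul_smul, ← Complex.exp_add, smul_eq_mul, ← integral_const_mul]
    congr 1 with y
    rw [← Complex.exp_add]
    congr 1
    have : ((‖ξ‖ : ℝ) : ℂ) ^ 2 = (ξ : ℂ) ^ 2 := by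
      rw [← Complex.ofReal_pow, ← Complex.ofReal_pow, Real.norm_eq_abs, sq_abs]
    rw [this]
    push_cast
    ring
  simp_rw [h1]
  -- The Gaussian damping legitimises Fubini. The inner integral is then the Fourier transform of a
  -- Gaussian, so the regularised inversion integral is an average over `μ` of a positive kernel.
  rw [integral_integral_swap hint, ← integral_complex_ofReal]
  congr 1 with y
  rw [integral_cexp_quadratic (by simpa using hc)]
  have h3 : (π : ℂ) / -(-(c⁻¹ : ℝ) : ℂ) = ((π * c : ℝ) : ℂ) := by
    push_cast; field_simp
  rw [h3, Complex.ofReal_mul √(π * c), Complex.ofReal_exp, Real.sqrt_eq_rpow,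
    Complex.ofReal_cpow (by positivity)]
  congr 2
  · norm_num
  · push_cast
    have : (c : ℂ) ≠ 0 := by exact_mod_cast hc.ne'
    field_simp
    ring_nf
    rw [Complex.I_sq]
    ring

/-- By Tonelli, since the kernel has total mass one in `x` for every `y`. This is the uniform bound
that Fatou's lemma needs below. -/
theorem lintegral_gaussian_average_le_one (μ : Measure ℝ) [IsProbabilityMeasure μ] {c : ℝ}
    (hc : 0 < c) :
    ∫⁻ x : ℝ, ENNReal.ofReal (∫ y, √(π * c) * Real.exp (-(π ^ 2 * c) * (y - x) ^ 2) ∂μ) ≤ 1 := by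
  set k : ℝ → ℝ := fun u => √(π * c) * Real.exp (-(π ^ 2 * c) * u ^ 2) with hk
  have hk0 : ∀ u, 0 ≤ k u := fun u => by positivity
  have hkc : Continuous k := by fun_prop
  have hb : ∀ u, k u ≤ √(π * c) := fun u => by
    refine mul_le_of_le_one_right (by positivity) (Real.exp_le_one_iff.mpr ?_)
    have : 0 ≤ π ^ 2 * c * u ^ 2 := by positivity
    linarith
  have h1 : ∀ x, ENNReal.ofReal (∫ y, k (y - x) ∂μ) = ∫⁻ y, ENNReal.ofReal (k (y - x)) ∂μ := by
    intro x
    refine ofReal_integral_eq_lintegral_ofReal ?_ (ae_of_all _ fun y => hk0 _)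
    exact (integrable_const (√(π * c))).mono' (by fun_prop) (ae_of_all _ fun y => by
      rw [Real.norm_of_nonneg (hk0 _)]; exact hb _)
  have h2 : ∫⁻ u, ENNReal.ofReal (k u) = 1 := by
    have hi : Integrable k := (integrable_exp_neg_mul_sq (by positivity)).const_mul _
    rw [← ofReal_integral_eq_lintegral_ofReal hi (ae_of_all _ hk0), hk,
      integral_const_mul, integral_gaussian, ← Real.sqrt_mul (by positivity)]
    have : π * c * (π / (π ^ 2 * c)) = 1 := by field_simp
    rw [this]; simp
  change ∫⁻ x : ℝ, ENNReal.ofReal (∫ y, k (y - x) ∂μ) ≤ 1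
  simp_rw [h1]
  rw [lintegral_lintegral_swap (by fun_prop)]
  have h3 : ∀ y : ℝ, ∫⁻ x, ENNReal.ofReal (k (y - x)) = 1 := fun y => by
    rw [lintegral_sub_left_eq_self (fun u => ENNReal.ofReal (k u)), h2]
  simp [h3]

/-- A probability measure on `ℝ` with integrable characteristic function has a bounded continuous
density, whose supremum norm is at most `(2π)⁻¹` times the `L¹`-norm of the characteristic
function. -/
theorem exists_continuous_density_of_integrable_charFun (μ : Measure ℝ) [IsProbabilityMeasure μ]
    (h : Integrable (charFun μ)) :
    ∃ f : ℝ →ᵇ ℝ, (∀ x, 0 ≤ f x) ∧ Integrable f ∧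
      μ = volume.withDensity (fun x => ENNReal.ofReal (f x)) ∧
      ‖f‖ ≤ (2 * π)⁻¹ * ∫ t, ‖charFun μ t‖ := by
  set Φ : ℝ → ℂ := fun ξ => charFun μ (2 * π * ξ) with hΦ
  have hΦi : Integrable Φ := h.comp_mul_left' (by positivity)
  have hΦc : Continuous Φ := by
    have : Continuous (charFun μ) := continuous_charFun
    fun_prop
  have hFeq : ∀ x, 𝓕 Φ x = ∫ ξ : ℝ, Complex.exp (↑(-2 * π * ξ * x) * Complex.I) • Φ ξ := by
    intro x
    rw [Real.fourier_eq']
    congr 1 with ξ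
    simp only [RCLike.inner_apply, conj_trivial]
    congr 4
    ring
  have hFc : Continuous (𝓕 Φ) :=
    VectorFourier.fourierIntegral_continuous Real.continuous_fourierChar
      (by exact continuous_inner) hΦi
  set g : ℝ → ℝ → ℝ := fun c x => ∫ y, √(π * c) * Real.exp (-(π ^ 2 * c) * (y - x) ^ 2) ∂μ with hg
  have hg0 : ∀ c x, 0 ≤ g c x := fun c x => integral_nonneg fun y => by positivity
  -- Removing the damping: `𝓕 Φ` inherits reality and nonnegativity from the averages `g c`.
  have hlim : ∀ x, Tendsto (fun c => ((g c x : ℝ) : ℂ)) atTop (𝓝 (𝓕 Φ x)) := by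
    intro x
    rw [hFeq]
    have hi : Integrable (fun ξ : ℝ => Complex.exp (↑(-2 * π * ξ * x) * Complex.I) • Φ ξ) := by
      refine hΦi.norm.mono' (by fun_prop) (ae_of_all _ fun ξ => ?_)
      rw [norm_smul, Complex.norm_exp_ofReal_mul_I, one_mul]
    refine (Real.tendsto_integral_cexp_sq_smul hi).congr' ?_
    filter_upwards [eventually_gt_atTop 0] with c hc
    exact integral_cexp_gaussian_mul_charFun μ hc x
  have hlimr : ∀ x, Tendsto (fun c => g c x) atTop (𝓝 (𝓕 Φ x).re) := fun x =>
    (Complex.continuous_re.tendsto _).comp (hlim x)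
  have hreal : ∀ x, 𝓕 Φ x = ((𝓕 Φ x).re : ℂ) := fun x =>
    tendsto_nhds_unique (hlim x) ((Complex.continuous_ofReal.tendsto _).comp (hlimr x))
  have hnn : ∀ x, 0 ≤ (𝓕 Φ x).re := fun x => ge_of_tendsto' (hlimr x) fun c => hg0 c x
  have hnorm : ∀ x, ‖(𝓕 Φ x).re‖ ≤ (2 * π)⁻¹ * ∫ t, ‖charFun μ t‖ := by
    intro x
    have h1 : ‖(𝓕 Φ x).re‖ ≤ ‖𝓕 Φ x‖ := by
      conv_rhs => rw [hreal x]
      rw [Complex.norm_real]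
    have h2 : ‖𝓕 Φ x‖ ≤ ∫ ξ, ‖Φ ξ‖ := VectorFourier.norm_fourierIntegral_le_integral_norm _ _ _ _ _
    have h3 : ∫ ξ, ‖Φ ξ‖ = (2 * π)⁻¹ * ∫ t, ‖charFun μ t‖ := by
      have := Measure.integral_comp_mul_left (fun t => ‖charFun μ t‖) (2 * π)
      rw [hΦ, this, abs_of_pos (by positivity), smul_eq_mul]
    linarith
  set f : ℝ →ᵇ ℝ := BoundedContinuousFunction.ofNormedAddCommGroup (fun x => (𝓕 Φ x).re)
    (Complex.continuous_re.comp hFc) _ hnorm with hf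
  have hfx : ∀ x, f x = (𝓕 Φ x).re := fun x => rfl
  have hf0 : ∀ x, 0 ≤ f x := hnn
  -- Integrability of `f` is not known beforehand; it comes from Fatou along `c = n + 1`, where `c >
  -- 0` is automatic.
  have hlint : ∫⁻ x, ENNReal.ofReal (f x) ≤ 1 := by
    have hseq : ∀ x, ENNReal.ofReal (f x) =
        liminf (fun n : ℕ => ENNReal.ofReal (g (n + 1) x)) atTop := by
      intro x
      refine (Tendsto.liminf_eq ?_).symm
      refine (ENNReal.continuous_ofReal.tendsto _).comp ((hlimr x).comp ?_)
      exact tendsto_atTop_add_const_right _ _ tendsto_natCast_atTop_atTop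
    simp_rw [hseq]
    refine (lintegral_liminf_le fun n => ?_).trans ?_
    · refine ENNReal.measurable_ofReal.comp ?_
      refine StronglyMeasurable.measurable ?_
      exact StronglyMeasurable.integral_prod_right'
        (f := fun p : ℝ × ℝ => √(π * ((n : ℝ) + 1)) *
          Real.exp (-(π ^ 2 * ((n : ℝ) + 1)) * (p.2 - p.1) ^ 2))
        (by fun_prop : Continuous _).stronglyMeasurable
    · refine liminf_le_of_frequently_le' (Eventually.frequently (Eventually.of_forall fun n => ?_))
      exact lintegral_gaussian_average_le_one μ (by positivity)
  have hfi : Integrable f := by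
    refine ⟨f.continuous.aestronglyMeasurable, ?_⟩
    rw [hasFiniteIntegral_iff_ofReal (ae_of_all _ hf0)]
    exact hlint.trans_lt ENNReal.one_lt_top
  refine ⟨f, hnn, hfi, ?_, ?_⟩
  · have hFi : Integrable (𝓕 Φ) := by
      have : 𝓕 Φ = fun x => ((f x : ℝ) : ℂ) := funext hreal
      rw [this]
      exact hfi.ofReal
    have hinv := hΦc.fourierInv_fourier_eq hΦi hFi
    have : IsFiniteMeasure (volume.withDensity fun x => ENNReal.ofReal (f x)) :=
      isFiniteMeasure_withDensity_ofReal hfi.2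
    -- With `Φ` and `𝓕 Φ` both integrable, Fourier inversion holds pointwise, so the two measures
    -- share their characteristic function.
    refine Measure.ext_of_charFun (funext fun t => ?_)
    have h1 : charFun μ t = Φ (t / (2 * π)) := by
      rw [hΦ]; simp only; congr 1; field_simp
    rw [h1, ← hinv, Real.fourierInv_eq', charFun_apply_real,
      integral_withDensity_eq_integral_toReal_smul (by fun_prop) (by simp)]
    congr 1 with x
    rw [ENNReal.toReal_ofReal (hf0 x), hreal x, smul_eq_mul, hfx, mul_comm]
    simp only [RCLike.inner_apply, conj_trivial, Complex.real_smul]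
    congr 2
    push_cast
    have : (π : ℂ) ≠ 0 := by exact_mod_cast Real.pi_ne_zero
    field_simp
  · refine (BoundedContinuousFunction.norm_le (by positivity)).mpr hnorm

end FourierInversionOfMeasures

/-! ### Decay of `J₀` and its role as a characteristic function -/

section BesselFunction

open Real intervalIntegral

theorem continuous_besselJ0 : Continuous besselJ0 := by
  unfold besselJ0
  exact continuous_const.mul (continuous_parametric_intervalIntegral_of_continuous'
    (f := fun x θ : ℝ => Real.cos (x * Real.sin θ)) (by fun_prop) 0 π)

theorem besselJ0_neg (x : ℝ) : besselJ0 (-x) = besselJ0 x := by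
  simp [besselJ0, neg_mul, Real.cos_neg]

theorem besselJ0_abs (x : ℝ) : besselJ0 |x| = besselJ0 x := by
  rcases abs_choice x with h | h <;> rw [h]
  exact besselJ0_neg x

theorem abs_besselJ0_le_one (x : ℝ) : |besselJ0 x| ≤ 1 := by
  have h : ‖∫ θ in (0 : ℝ)..π, Real.cos (x * Real.sin θ)‖ ≤ 1 * |π - 0| :=
    norm_integral_le_of_norm_le_const fun θ _ => Real.abs_cos_le_one _
  rw [sub_zero, abs_of_pos pi_pos, one_mul, Real.norm_eq_abs] at h
  rw [besselJ0, abs_mul, abs_of_pos (by positivity), one_div]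
  calc π⁻¹ * _ ≤ π⁻¹ * π := by gcongr
    _ = 1 := inv_mul_cancel₀ pi_ne_zero

/-- Reflection about `π/2` moves the stationary point of the phase `x sin θ` to an endpoint. -/
theorem besselJ0_eq_quarter (x : ℝ) :
    besselJ0 x = 2 / π * ∫ θ in (0 : ℝ)..π / 2, Real.cos (x * Real.sin θ) := by
  have hc : Continuous fun θ : ℝ => Real.cos (x * Real.sin θ) := by fun_prop
  have h1 : ∫ θ in (π / 2)..π, Real.cos (x * Real.sin θ) =
      ∫ θ in (0 : ℝ)..π / 2, Real.cos (x * Real.sin θ) := by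
    have := integral_comp_sub_left (a := 0) (b := π / 2)
      (fun θ : ℝ => Real.cos (x * Real.sin θ)) π
    simp only [Real.sin_pi_sub, sub_zero] at this
    rw [this]
    congr 1
    ring
  rw [besselJ0, ← integral_add_adjacent_intervals (hc.intervalIntegrable 0 (π / 2))
    (hc.intervalIntegrable (π / 2) π), h1]
  ring

/-- First-derivative test: integrate by parts against `1/(x cos θ)`, the reciprocal of the phase
derivative. It increases along the interval, so the boundary term and the remaining integral are
each at most `1/(x sin η)`. -/
theorem abs_integral_cos_mul_sin_le {x η : ℝ} (hx : 0 < x) (hη : 0 < η) (hη' : η < π / 2) :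
    |∫ θ in (0 : ℝ)..π / 2 - η, Real.cos (x * Real.sin θ)| ≤ 2 / (x * Real.sin η) := by
  set b := π / 2 - η with hb
  have hb0 : 0 ≤ b := by linarith
  have hcos : ∀ θ ∈ Set.uIcc 0 b, 0 < Real.cos θ := fun θ hθ => by
    rw [Set.uIcc_of_le hb0] at hθ
    exact Real.cos_pos_of_mem_Ioo ⟨by linarith [hθ.1], by linarith [hθ.2]⟩
  have hcb : Real.cos b = Real.sin η := by rw [hb, Real.cos_pi_div_two_sub]
  have hsη : 0 < Real.sin η := hcb ▸ hcos b Set.right_mem_uIcc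
  have hu : ∀ θ ∈ Set.uIcc 0 b, HasDerivAt (fun θ => (x * Real.cos θ)⁻¹)
      (x * Real.sin θ / (x * Real.cos θ) ^ 2) θ := fun θ hθ => by
    have := ((Real.hasDerivAt_cos θ).const_mul x).fun_inv (by have := hcos θ hθ; positivity)
    refine this.congr_deriv ?_
    ring
  have hv : ∀ θ ∈ Set.uIcc 0 b, HasDerivAt (fun θ => Real.sin (x * Real.sin θ))
      (Real.cos (x * Real.sin θ) * (x * Real.cos θ)) θ := fun θ _ =>
    ((Real.hasDerivAt_sin θ).const_mul x).sin
  have hu'c : ContinuousOn (fun θ => x * Real.sin θ / (x * Real.cos θ) ^ 2) (Set.uIcc 0 b) := by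
    refine ContinuousOn.div (by fun_prop) (by fun_prop) fun θ hθ => ?_
    have := hcos θ hθ
    positivity
  have hibp := integral_mul_deriv_eq_deriv_mul hu hv hu'c.intervalIntegrable
    (by fun_prop : Continuous _).continuousOn.intervalIntegrable
  have hu'int := integral_eq_sub_of_hasDerivAt hu hu'c.intervalIntegrable
  have hleft : ∫ θ in (0 : ℝ)..b, (x * Real.cos θ)⁻¹ *
      (Real.cos (x * Real.sin θ) * (x * Real.cos θ)) =
      ∫ θ in (0 : ℝ)..b, Real.cos (x * Real.sin θ) := by
    refine integral_congr fun θ hθ => ?_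
    have := hcos θ hθ
    field_simp
  rw [hleft] at hibp
  have hbound : ‖∫ θ in (0 : ℝ)..b, x * Real.sin θ / (x * Real.cos θ) ^ 2 *
      Real.sin (x * Real.sin θ)‖ ≤ ∫ θ in (0 : ℝ)..b, x * Real.sin θ / (x * Real.cos θ) ^ 2 := by
    refine norm_integral_le_of_norm_le hb0 (ae_of_all _ fun θ hθ => ?_) hu'c.intervalIntegrable
    have hs : 0 ≤ Real.sin θ :=
      Real.sin_nonneg_of_nonneg_of_le_pi hθ.1.le (by linarith [hθ.2, pi_pos])
    rw [norm_mul, Real.norm_of_nonneg (by positivity)]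
    exact mul_le_of_le_one_right (by positivity) (Real.abs_sin_le_one _)
  rw [hu'int, Real.norm_eq_abs] at hbound
  rw [hibp, hcb]
  simp only [Real.sin_zero, mul_zero, sub_zero, Real.cos_zero, mul_one]
  rw [hcb, Real.cos_zero, mul_one] at hbound
  have h1 : |(x * Real.sin η)⁻¹ * Real.sin (x * Real.sin b)| ≤ (x * Real.sin η)⁻¹ := by
    rw [abs_mul, abs_of_pos (by positivity)]
    exact mul_le_of_le_one_right (by positivity) (Real.abs_sin_le_one _)
  have h2 : 0 < x⁻¹ := by positivity
  have h3 := abs_sub ((x * Real.sin η)⁻¹ * Real.sin (x * Real.sin b))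
    (∫ θ in (0 : ℝ)..b, x * Real.sin θ / (x * Real.cos θ) ^ 2 * Real.sin (x * Real.sin θ))
  have h4 : 2 / (x * Real.sin η) = 2 * (x * Real.sin η)⁻¹ := by ring
  linarith

theorem abs_besselJ0_le {x : ℝ} (hx : 0 < x) : |besselJ0 x| ≤ 3 / √x := by
  have hsx : 0 < √x := Real.sqrt_pos.mpr hx
  rcases lt_or_ge x 1 with h1 | h1
  · refine (abs_besselJ0_le_one x).trans ?_
    rw [le_div_iff₀ hsx]
    have : √x ≤ 1 := Real.sqrt_le_one.mpr h1.le
    linarith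
  -- This width balances the trivial bound `η` near the stationary point against the bound of order
  -- `1/(xη)` away from it.
  · set η := 1 / √x with hη
    have hs1 : 1 ≤ √x := Real.one_le_sqrt.mpr h1
    have hη0 : 0 < η := by positivity
    have hη1 : η ≤ 1 := by rw [hη, div_le_one hsx]; exact hs1
    have hηpi : η < π / 2 := by linarith [pi_gt_three]
    have hc : Continuous fun θ : ℝ => Real.cos (x * Real.sin θ) := by fun_prop
    have h2 := abs_integral_cos_mul_sin_le hx hη0 hηpi
    have h3 : ‖∫ θ in (π / 2 - η)..π / 2, Real.cos (x * Real.sin θ)‖ ≤ 1 * |π / 2 - (π / 2 - η)| :=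
      norm_integral_le_of_norm_le_const fun θ _ => Real.abs_cos_le_one _
    rw [sub_sub_cancel, abs_of_pos hη0, one_mul, Real.norm_eq_abs] at h3
    have h4 : 2 / (x * Real.sin η) ≤ π * η := by
      have hsin : 2 / π * η ≤ Real.sin η := Real.mul_le_sin hη0.le hηpi.le
      have hxη : x * η = √x := by
        rw [hη, mul_one_div, Real.div_sqrt]
      calc 2 / (x * Real.sin η) ≤ 2 / (x * (2 / π * η)) := by gcongr
        _ = π / (x * η) := by field_simp
        _ = π * η := by rw [hxη, hη]; ring
    rw [besselJ0_eq_quarter, ← integral_add_adjacent_intervals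
      (hc.intervalIntegrable 0 (π / 2 - η)) (hc.intervalIntegrable (π / 2 - η) (π / 2)),
      abs_mul, abs_of_pos (by positivity)]
    calc 2 / π * _ ≤ 2 / π * (π * η + η) := by
          gcongr
          exact (abs_add_le _ _).trans (add_le_add (h2.trans h4) h3)
      _ = (2 + 2 / π) * η := by field_simp
      _ ≤ 3 * η := by
          gcongr
          have : 2 / π ≤ 1 := by rw [div_le_one pi_pos]; linarith [pi_gt_three]
          linarith
      _ = 3 / √x := by rw [hη]; ring

/-- Three factors give the integrable decay `t^(-3/2)` and the others are at most one; two would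
only give `t^(-1)`. -/
theorem integrableOn_prod_abs_besselJ0 {M : ℕ} (hM : 3 ≤ M) {b : ℕ → ℝ} (hb : ∀ k, 0 < b k) :
    IntegrableOn (fun t : ℝ => ∏ k ∈ Finset.range M, |besselJ0 (b k * t)|) (Set.Ioi 0) := by
  have hcont : Continuous fun t : ℝ => ∏ k ∈ Finset.range M, |besselJ0 (b k * t)| :=
    continuous_finsetProd _ fun k _ => (continuous_besselJ0.comp (by fun_prop)).abs
  have hsplit : Set.Ioi (0 : ℝ) = Set.Ioc 0 1 ∪ Set.Ioi 1 :=
    (Set.Ioc_union_Ioi_eq_Ioi zero_le_one).symm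
  rw [hsplit]
  refine IntegrableOn.union ((hcont.integrableOn_Icc).mono_set Set.Ioc_subset_Icc_self) ?_
  have hrpow : IntegrableOn (fun t : ℝ => (∏ k ∈ Finset.range 3, 3 / √(b k)) * t ^ (-(3 / 2) : ℝ))
      (Set.Ioi 1) := (integrableOn_Ioi_rpow_of_lt (by norm_num) one_pos).const_mul _
  refine hrpow.mono' hcont.aestronglyMeasurable ?_
  filter_upwards [ae_restrict_mem measurableSet_Ioi] with t ht
  have ht0 : (0 : ℝ) < t := one_pos.trans ht
  rw [Real.norm_of_nonneg (Finset.prod_nonneg fun _ _ => abs_nonneg _)]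
  calc ∏ k ∈ Finset.range M, |besselJ0 (b k * t)|
      ≤ ∏ k ∈ Finset.range 3, |besselJ0 (b k * t)| :=
        Finset.prod_le_prod_of_subset_of_le_one (Finset.range_mono hM)
          (fun _ _ => abs_nonneg _) (fun _ _ _ => abs_besselJ0_le_one _)
    _ ≤ ∏ k ∈ Finset.range 3, (3 / √(b k) * (1 / √t)) := by
        refine Finset.prod_le_prod (fun _ _ => abs_nonneg _) fun k _ => ?_
        refine (abs_besselJ0_le (mul_pos (hb k) ht0)).trans (le_of_eq ?_)
        rw [Real.sqrt_mul (hb k).le]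
        field_simp
    _ = (∏ k ∈ Finset.range 3, 3 / √(b k)) * t ^ (-(3 / 2) : ℝ) := by
        rw [Finset.prod_mul_distrib]
        congr 1
        rw [Finset.prod_const, Finset.card_range, one_div, Real.sqrt_eq_rpow, ← Real.rpow_neg ht0.le,
          ← Real.rpow_natCast, ← Real.rpow_mul ht0.le]
        norm_num

/-- A quarter-period shift turns the cosine into the sine of Bessel's integral; pairing `y` with
`-y` cancels the imaginary part. -/
theorem integral_unitAddCircle_exp_cos (u : ℝ) :
    ∫ θ : UnitAddCircle, Complex.exp (u * (fourier 1 θ).re * Complex.I) = besselJ0 u := by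
  rw [← AddCircle.intervalIntegral_preimage 1 0]
  have h1 : ∀ x : ℝ, (fourier 1 (x : UnitAddCircle)).re = Real.cos (2 * π * x) := by
    intro x
    rw [fourier_coe_apply]
    have : 2 * (π : ℂ) * Complex.I * ((1 : ℤ) : ℂ) * x / ((1 : ℝ) : ℂ) =
      ((2 * π * x : ℝ) : ℂ) * Complex.I := by push_cast; ring
    rw [this, Complex.exp_ofReal_mul_I_re]
  simp_rw [h1]
  set F : ℝ → ℂ := fun y => Complex.exp (u * Real.sin y * Complex.I) with hF
  have hFc : Continuous F := by fun_prop
  have h2 : ∫ x in (0 : ℝ)..0 + 1, Complex.exp (u * Real.cos (2 * π * x) * Complex.I) =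
      (2 * π)⁻¹ • ∫ y in (π / 2)..(π / 2 + 2 * π), F y := by
    have := integral_comp_mul_add (a := 0) (b := 1) F (c := 2 * π) (by positivity) (π / 2)
    rw [mul_zero, mul_one, zero_add, add_comm (2 * π)] at this
    rw [← this, zero_add]
    simp only [hF, Real.sin_add_pi_div_two]
  have hper : Function.Periodic F (2 * π) := fun y => by
    simp only [hF, Real.sin_add_two_pi]
  have h3 : ∫ y in (π / 2)..(π / 2 + 2 * π), F y = ∫ y in (-π)..π, F y := by
    rw [hper.intervalIntegral_add_eq (π / 2) (-π)]
    congr 1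
    ring
  have h4 : ∫ y in (-π)..0, F y = ∫ y in (0 : ℝ)..π, F (-y) := by
    rw [integral_comp_neg, neg_zero]
  rw [h2, h3, ← integral_add_adjacent_intervals (hFc.intervalIntegrable (-π) 0)
    (hFc.intervalIntegrable 0 π), h4, ← integral_add
    ((by fun_prop : Continuous fun y => F (-y)).intervalIntegrable 0 π) (hFc.intervalIntegrable 0 π)]
  have h5 : ∀ y, F (-y) + F y = ((2 * Real.cos (u * Real.sin y) : ℝ) : ℂ) := by
    intro y
    simp only [hF, Real.sin_neg]
    push_cast
    rw [Complex.two_cos]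
    rw [add_comm]
    congr 2
    ring
  simp_rw [h5]
  rw [intervalIntegral.integral_ofReal, intervalIntegral.integral_const_mul, besselJ0,
    Complex.real_smul]
  push_cast
  have : (π : ℂ) ≠ 0 := by exact_mod_cast pi_ne_zero
  field_simp

end BesselFunction

/-! ### Weyl equidistribution on the torus -/

section Equidistribution

open Real intervalIntegral

instance isProbabilityMeasure_unitAddCircle :
    IsProbabilityMeasure (volume : Measure UnitAddCircle) :=
  ⟨UnitAddCircle.measure_univ⟩

variable {ι : Type*}

/-- The linear flow with frequencies `γ` on the torus. -/
noncomputable def torusFlow (γ : ι → ℝ) (δ : ℝ) : UnitAddTorus ι :=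
  fun k => ((γ k * δ / (2 * π) : ℝ) : UnitAddCircle)

theorem continuous_torusFlow (γ : ι → ℝ) : Continuous (torusFlow γ) :=
  continuous_pi fun _ => (AddCircle.continuous_mk' 1).comp (by fun_prop)

theorem fourier_one_re_torusFlow (γ : ι → ℝ) (δ : ℝ) (k : ι) :
    (fourier 1 (torusFlow γ δ k)).re = Real.cos (γ k * δ) := by
  rw [torusFlow, fourier_coe_apply]
  have : 2 * (π : ℂ) * Complex.I * ((1 : ℤ) : ℂ) * ((γ k * δ / (2 * π) : ℝ) : ℂ) / ((1 : ℝ) : ℂ) =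
      ((γ k * δ : ℝ) : ℂ) * Complex.I := by
    have : (π : ℂ) ≠ 0 := by exact_mod_cast pi_ne_zero
    push_cast
    field_simp
  rw [this, Complex.exp_ofReal_mul_I_re]

variable [Fintype ι]

theorem mFourier_torusFlow (γ : ι → ℝ) (n : ι → ℤ) (δ : ℝ) :
    UnitAddTorus.mFourier n (torusFlow γ δ) =
      Complex.exp (((∑ k, (n k : ℝ) * γ k : ℝ) * Complex.I) * δ) := by
  simp only [UnitAddTorus.mFourier, ContinuousMap.coe_mk, torusFlow, fourier_coe_apply]
  rw [← Complex.exp_sum]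
  congr 1
  push_cast
  rw [Finset.sum_mul, Finset.sum_mul]
  refine Finset.sum_congr rfl fun k _ => ?_
  have : (π : ℂ) ≠ 0 := by exact_mod_cast pi_ne_zero
  field_simp

/-- The integral factors over coordinates, and half a period of translation negates the factor with
nonzero frequency. -/
theorem integral_mFourier_of_ne_zero {n : ι → ℤ} (hn : n ≠ 0) :
    ∫ θ, UnitAddTorus.mFourier n θ = 0 := by
  obtain ⟨i, hi⟩ := Function.ne_iff.mp hn
  have h1 : ∫ θ : UnitAddTorus ι, UnitAddTorus.mFourier n θ =
      ∏ k, ∫ x : UnitAddCircle, fourier (n k) x :=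
    integral_fintype_prod_volume_eq_prod (fun k (x : UnitAddCircle) => fourier (n k) x)
  rw [h1]
  refine Finset.prod_eq_zero (Finset.mem_univ i) ?_
  have h2 := integral_eq_zero_of_add_right_eq_neg (μ := (volume : Measure UnitAddCircle))
    (fourier_add_half_inv_index hi (zero_lt_one' ℝ))
  exact h2

theorem tendsto_average_cexp {c : ℝ} (hc : c ≠ 0) :
    Tendsto (fun T : ℝ => (T : ℂ)⁻¹ * ∫ δ in (0 : ℝ)..T, Complex.exp ((c * Complex.I) * δ))
      atTop (𝓝 0) := by
  have hcI : (c : ℂ) * Complex.I ≠ 0 := by simp [hc]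
  have h : ∀ᶠ T : ℝ in atTop,
      ‖(T : ℂ)⁻¹ * ∫ δ in (0 : ℝ)..T, Complex.exp ((c * Complex.I) * δ)‖ ≤ 2 / |c| * T⁻¹ := by
    filter_upwards [eventually_gt_atTop 0] with T hT
    rw [integral_exp_mul_complex hcI, norm_mul, norm_inv, norm_div, norm_mul, Complex.norm_I,
      Complex.norm_real, Complex.norm_real, Real.norm_of_nonneg hT.le, mul_one, mul_comm,
      Real.norm_eq_abs]
    gcongr
    refine (norm_sub_le _ _).trans ?_
    have h1 : ∀ x : ℝ, ‖Complex.exp ((c * Complex.I) * x)‖ = 1 := fun x => by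
      have : (c * Complex.I) * x = ((c * x : ℝ) : ℂ) * Complex.I := by push_cast; ring
      rw [this, Complex.norm_exp_ofReal_mul_I]
    rw [h1, h1]
    norm_num
  refine squeeze_zero_norm' h ?_
  simpa using tendsto_inv_atTop_zero.const_mul (2 / |c|)

/-- Independence enters here: along the flow, a nontrivial character oscillates with frequency `∑
n_k γ_k ≠ 0`, so its averages vanish in the limit. -/
theorem tendsto_average_torusFlow_mFourier {γ : ι → ℝ}
    (hγ : ∀ n : ι → ℤ, ∑ k, (n k : ℝ) * γ k = 0 → n = 0) (n : ι → ℤ) :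
    Tendsto (fun T : ℝ => (T : ℂ)⁻¹ * ∫ δ in (0 : ℝ)..T, UnitAddTorus.mFourier n (torusFlow γ δ))
      atTop (𝓝 (∫ θ, UnitAddTorus.mFourier n θ)) := by
  by_cases hn : n = 0
  · subst hn
    simp only [UnitAddTorus.mFourier_zero, ContinuousMap.one_apply, intervalIntegral.integral_const, sub_zero,
      MeasureTheory.integral_const, probReal_univ, one_smul]
    refine tendsto_const_nhds.congr' ?_
    filter_upwards [eventually_ne_atTop 0] with T hT
    have : (T : ℂ) ≠ 0 := by exact_mod_cast hT
    rw [Complex.real_smul, mul_one, inv_mul_cancel₀ this]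
  · rw [integral_mFourier_of_ne_zero hn]
    simp_rw [mFourier_torusFlow]
    exact tendsto_average_cexp fun h => hn (hγ n h)

/-- **Weyl's equidistribution theorem** for linear flows on the torus with rationally independent
frequencies. -/
theorem tendsto_average_torusFlow {γ : ι → ℝ}
    (hγ : ∀ n : ι → ℤ, ∑ k, (n k : ℝ) * γ k = 0 → n = 0) (g : C(UnitAddTorus ι, ℂ)) :
    Tendsto (fun T : ℝ => (T : ℂ)⁻¹ * ∫ δ in (0 : ℝ)..T, g (torusFlow γ δ))
      atTop (𝓝 (∫ θ, g θ)) := by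
  have hint : ∀ (h : C(UnitAddTorus ι, ℂ)) (T : ℝ),
      IntervalIntegrable (fun δ => h (torusFlow γ δ)) volume 0 T := fun h T =>
    (h.continuous.comp (continuous_torusFlow γ)).intervalIntegrable 0 T
  have hint' : ∀ h : C(UnitAddTorus ι, ℂ), Integrable h := fun h =>
    (integrable_const ‖h‖).mono' h.continuous.aestronglyMeasurable
      (ae_of_all _ h.norm_coe_le_norm)
  have hspan : ∀ h ∈ Submodule.span ℂ (Set.range (UnitAddTorus.mFourier (d := ι))),
      Tendsto (fun T : ℝ => (T : ℂ)⁻¹ * ∫ δ in (0 : ℝ)..T, h (torusFlow γ δ))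
        atTop (𝓝 (∫ θ, h θ)) := by
    intro h hh
    induction hh using Submodule.span_induction with
    | mem x hx =>
      obtain ⟨n, rfl⟩ := hx
      exact tendsto_average_torusFlow_mFourier hγ n
    | zero => simp
    | add x y _ _ hx hy =>
      simp only [ContinuousMap.add_apply]
      rw [MeasureTheory.integral_add (hint' x) (hint' y)]
      refine (hx.add hy).congr fun T => ?_
      rw [intervalIntegral.integral_add (hint x T) (hint y T), mul_add]
    | smul a x _ hx =>
      simp only [ContinuousMap.smul_apply]
      rw [MeasureTheory.integral_smul]
      refine (hx.const_smul a).congr fun T => ?_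
      rw [intervalIntegral.integral_smul, smul_eq_mul, smul_eq_mul]
      ring
  -- Trigonometric polynomials are uniformly dense, and both the time average and the torus integral
  -- are contractions for the supremum norm.
  have hdense : g ∈ closure (Submodule.span ℂ (Set.range (UnitAddTorus.mFourier (d := ι))) :
      Set C(UnitAddTorus ι, ℂ)) := by
    rw [← Submodule.topologicalClosure_coe, UnitAddTorus.span_mFourier_closure_eq_top]
    trivial
  rw [Metric.tendsto_nhds]
  intro ε hε
  obtain ⟨h, hh, hgh⟩ := Metric.mem_closure_iff.mp hdense (ε / 3) (by positivity)
  have hpt : ∀ θ, ‖g θ - h θ‖ ≤ ε / 3 := fun θ =>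
    ((g - h).norm_coe_le_norm θ).trans (by rw [← dist_eq_norm]; exact hgh.le)
  filter_upwards [Metric.tendsto_nhds.mp (hspan h hh) (ε / 3) (by positivity),
    eventually_gt_atTop 0] with T hT hT0
  have h1 : dist ((T : ℂ)⁻¹ * ∫ δ in (0 : ℝ)..T, g (torusFlow γ δ))
      ((T : ℂ)⁻¹ * ∫ δ in (0 : ℝ)..T, h (torusFlow γ δ)) ≤ ε / 3 := by
    rw [dist_eq_norm, ← mul_sub, ← intervalIntegral.integral_sub (hint g T) (hint h T), norm_mul,
      norm_inv, Complex.norm_real, Real.norm_of_nonneg hT0.le]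
    have := intervalIntegral.norm_integral_le_of_norm_le_const (a := 0) (b := T)
      (f := fun δ => g (torusFlow γ δ) - h (torusFlow γ δ)) fun δ _ => hpt (torusFlow γ δ)
    rw [sub_zero, abs_of_pos hT0] at this
    rw [inv_mul_le_iff₀ hT0]
    linarith
  have h2 : dist (∫ θ, h θ) (∫ θ, g θ) ≤ ε / 3 := by
    rw [dist_comm, dist_eq_norm, ← MeasureTheory.integral_sub (hint' g) (hint' h)]
    refine (MeasureTheory.norm_integral_le_of_norm_le_const (ae_of_all _ hpt)).trans ?_
    rw [probReal_univ, mul_one]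
  have h3 := dist_triangle4 ((T : ℂ)⁻¹ * ∫ δ in (0 : ℝ)..T, g (torusFlow γ δ))
      ((T : ℂ)⁻¹ * ∫ δ in (0 : ℝ)..T, h (torusFlow γ δ)) (∫ θ, h θ) (∫ θ, g θ)
  linarith

theorem tendsto_average_torusFlow_real {γ : ι → ℝ}
    (hγ : ∀ n : ι → ℤ, ∑ k, (n k : ℝ) * γ k = 0 → n = 0) {g : UnitAddTorus ι → ℝ}
    (hg : Continuous g) :
    Tendsto (fun T : ℝ => (∫ δ in (0 : ℝ)..T, g (torusFlow γ δ)) / T)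
      atTop (𝓝 (∫ θ, g θ)) := by
  have h := tendsto_average_torusFlow hγ ⟨fun θ => (g θ : ℂ), by fun_prop⟩
  simp only [ContinuousMap.coe_mk] at h
  rw [integral_complex_ofReal] at h
  refine ((Complex.continuous_re.tendsto _).comp h).congr fun T => ?_
  simp only [Function.comp_apply]
  rw [intervalIntegral.integral_ofReal, ← Complex.ofReal_inv, ← Complex.ofReal_mul,
    Complex.ofReal_re, div_eq_inv_mul]

/-- The random variable `∑ b_k cos(2πθ_k)` on the torus. -/
noncomputable def cosineSum (b : ι → ℝ) (θ : UnitAddTorus ι) : ℝ :=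
  ∑ k, b k * (fourier 1 (θ k)).re

theorem continuous_cosineSum (b : ι → ℝ) : Continuous (cosineSum b) := by
  unfold cosineSum
  fun_prop

/-- The coordinates are independent under the product measure, so the characteristic function
factors. -/
theorem charFun_map_cosineSum (b : ι → ℝ) (t : ℝ) :
    charFun (Measure.map (cosineSum b) volume) t = ((∏ k, besselJ0 (b k * t) : ℝ) : ℂ) := by
  rw [charFun_apply_real, integral_map (continuous_cosineSum b).aemeasurable (by fun_prop)]
  have h1 : ∀ θ : UnitAddTorus ι, Complex.exp (t * cosineSum b θ * Complex.I) =
      ∏ k, Complex.exp ((b k * t : ℝ) * (fourier 1 (θ k)).re * Complex.I) := by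
    intro θ
    rw [← Complex.exp_sum, cosineSum]
    congr 1
    push_cast
    rw [Finset.mul_sum, Finset.sum_mul]
    exact Finset.sum_congr rfl fun k _ => by ring
  simp_rw [h1]
  have h2 := integral_fintype_prod_volume_eq_prod (𝕜 := ℂ) (fun k (x : UnitAddCircle) =>
    Complex.exp ((b k * t : ℝ) * (fourier 1 x).re * Complex.I))
  rw [h2]
  simp_rw [integral_unitAddCircle_exp_cos]
  push_cast
  rfl

end Equidistribution

/-! ### The limiting density and the measure of a small window -/

section CesaroDistribution

theorem prod_range_abs_besselJ0_comp_abs {M : ℕ} {b : ℕ → ℝ} (hb : ∀ k, 0 < b k) (t : ℝ) :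
    ∏ k ∈ Finset.range M, |besselJ0 (b k * |t|)| = ∏ k ∈ Finset.range M, |besselJ0 (b k * t)| := by
  refine Finset.prod_congr rfl fun k _ => ?_
  rw [← besselJ0_abs (b k * t), abs_mul, abs_of_pos (hb k)]

theorem exists_isCesaroPDF_cosineSum {M : ℕ} (hM : 3 ≤ M) {b γ : ℕ → ℝ} (hb : ∀ k, 0 < b k)
    (hγ : ∀ n : Fin M → ℤ, ∑ k, (n k : ℝ) * γ k = 0 → n = 0) :
    ∃ f : ℝ →ᵇ ℝ,
      IsCesaroPDF (fun δ => ∑ k ∈ Finset.range M, b k * Real.cos (γ k * δ)) f ∧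
      ‖f‖ ≤ (1 / Real.pi) *
        ∫ t in Set.Ioi (0 : ℝ), ∏ k ∈ Finset.range M, |besselJ0 (b k * t)| := by
  set X : UnitAddTorus (Fin M) → ℝ := cosineSum fun k : Fin M => b k with hX
  have hXc : Continuous X := continuous_cosineSum _
  set μ : Measure ℝ := Measure.map X volume with hμ
  have : IsProbabilityMeasure μ := Measure.isProbabilityMeasure_map hXc.aemeasurable
  have hchar : ∀ t, ‖charFun μ t‖ = ∏ k ∈ Finset.range M, |besselJ0 (b k * t)| := by
    intro t
    rw [hμ, hX, charFun_map_cosineSum, Complex.norm_real, Real.norm_eq_abs, Finset.abs_prod,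
      Finset.prod_range fun k => |besselJ0 (b k * t)|]
  have hinteg : Integrable (charFun μ) := by
    rw [← integrable_norm_iff (by fun_prop)]
    simp_rw [hchar]
    have h0 := integrableOn_prod_abs_besselJ0 hM hb
    have h1 : IntegrableOn (fun t : ℝ => ∏ k ∈ Finset.range M, |besselJ0 (b k * t)|)
        (Set.Iic 0) := by
      have h2 : IntegrableOn (fun t : ℝ => ∏ k ∈ Finset.range M, |besselJ0 (b k * -t)|)
          (Set.Ioi 0) := by
        simpa only [mul_neg, besselJ0_neg] using h0
      have h3 := (Iff.mpr integrableOn_Ici_iff_integrableOn_Ioi h2).comp_neg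
      simpa using h3
    rw [← integrableOn_univ, ← Set.Iic_union_Ioi (a := (0 : ℝ))]
    exact h1.union h0
  obtain ⟨f, hf0, hfi, hμf, hfn⟩ := exists_continuous_density_of_integrable_charFun μ hinteg
  have hdens : ∀ g : ℝ → ℝ, ∫ x, g x ∂μ = ∫ x, g x * f x := by
    intro g
    rw [hμf, integral_withDensity_eq_integral_toReal_smul (by fun_prop) (by simp)]
    congr 1 with x
    rw [ENNReal.toReal_ofReal (hf0 x), smul_eq_mul, mul_comm]
  refine ⟨f, ⟨hf0, hfi, ?_, fun g => ?_⟩, hfn.trans_eq ?_⟩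
  · have := hdens fun _ => 1
    simpa using this.symm
  · rw [← hdens g, hμ, integral_map hXc.aemeasurable g.continuous.aestronglyMeasurable]
    refine (tendsto_average_torusFlow_real hγ (g.continuous.comp hXc)).congr fun T => ?_
    congr 2 with δ
    simp only [Function.comp_apply, hX, cosineSum, fourier_one_re_torusFlow]
    rw [Finset.sum_range fun k => b k * Real.cos (γ k * δ)]
  -- By evenness the integral over `ℝ` is twice that over the half-line, which turns `1/(2π)` into
  -- `1/π`.
  · simp_rw [hchar]
    have h1 := integral_comp_abs (f := fun t => ∏ k ∈ Finset.range M, |besselJ0 (b k * t)|)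
    simp_rw [prod_range_abs_besselJ0_comp_abs hb] at h1
    rw [h1]
    field_simp

/-- Weak convergence tests only continuous functions, so the indicator of `[-η, η]` is majorised by
a trapezoid supported in `[-(η + ε), η + ε]`. The last `+ ε` is the slack that turns the limit into
an eventual bound. Only monotonicity is applied to `A`, so it need not be measurable. -/
theorem eventually_volume_real_div_le {S : ℝ → ℝ} (hS : Continuous S) {f : ℝ →ᵇ ℝ}
    (hf : IsCesaroPDF S f) {η : ℝ} (hη : 0 ≤ η) {A : Set ℝ} (hA : A ⊆ {δ | |S δ| ≤ η})
    {ε : ℝ} (hε : 0 < ε) :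
    ∀ᶠ T in atTop, volume.real (A ∩ Set.Icc 0 T) / T ≤ 2 * ‖f‖ * (η + ε) + ε := by
  set g : ℝ →ᵇ ℝ := BoundedContinuousFunction.ofNormedAddCommGroup
    (fun x : ℝ => max 0 (min 1 (1 - (|x| - η) / ε))) (by fun_prop) 1 (fun x => by
      rw [Real.norm_of_nonneg (le_max_left _ _)]
      exact max_le zero_le_one (min_le_left _ _)) with hg
  have hgx : ∀ x, g x = max 0 (min 1 (1 - (|x| - η) / ε)) := fun x => rfl
  have hg0 : ∀ x, 0 ≤ g x := fun x => le_max_left _ _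
  have hg1 : ∀ x, g x ≤ 1 := fun x => max_le zero_le_one (min_le_left _ _)
  have hgη : ∀ x, |x| ≤ η → 1 ≤ g x := fun x hx => by
    refine le_max_of_le_right (le_min le_rfl ?_)
    have : (|x| - η) / ε ≤ 0 := div_nonpos_of_nonpos_of_nonneg (by linarith) hε.le
    linarith
  have hgs : ∀ x, g x * f x ≤ (Set.Icc (-(η + ε)) (η + ε)).indicator (fun _ => ‖f‖) x := by
    intro x
    by_cases hx : x ∈ Set.Icc (-(η + ε)) (η + ε)
    · rw [Set.indicator_of_mem hx]
      calc g x * f x ≤ 1 * ‖f‖ := mul_le_mul (hg1 x)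
            ((le_abs_self _).trans (f.norm_coe_le_norm x)) (hf.nonneg x) zero_le_one
        _ = ‖f‖ := one_mul _
    · rw [Set.indicator_of_notMem hx]
      have h1 : η + ε < |x| := by
        rw [Set.mem_Icc, ← abs_le] at hx
        exact not_le.mp hx
      have h2 : g x = 0 := by
        rw [hgx]
        refine max_eq_left (min_le_of_right_le ?_)
        have : 1 ≤ (|x| - η) / ε := by rw [le_div_iff₀ hε]; linarith
        linarith
      rw [h2, zero_mul]
  have hgi : ∫ x, g x * f x ≤ 2 * ‖f‖ * (η + ε) := by
    have h1 : ∫ x, (Set.Icc (-(η + ε)) (η + ε)).indicator (fun _ => ‖f‖) x =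
        2 * ‖f‖ * (η + ε) := by
      rw [integral_indicator measurableSet_Icc, setIntegral_const, Real.volume_real_Icc_of_le
        (by linarith), smul_eq_mul]
      ring
    rw [← h1]
    refine integral_mono_of_nonneg (ae_of_all _ fun x => mul_nonneg (hg0 x) (hf.nonneg x)) ?_
      (ae_of_all _ hgs)
    exact (integrable_indicator_iff measurableSet_Icc).mpr (integrableOn_const (by simp))
  have hev := (hf.tendsto g).eventually (eventually_lt_nhds (b := 2 * ‖f‖ * (η + ε) + ε)
    (by linarith))
  filter_upwards [hev, eventually_gt_atTop 0] with T hT hT0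
  refine le_trans ?_ hT.le
  gcongr
  set B : Set ℝ := {δ | |S δ| ≤ η} with hB
  have hBm : MeasurableSet B := (isClosed_le hS.abs continuous_const).measurableSet
  calc volume.real (A ∩ Set.Icc 0 T) ≤ volume.real (B ∩ Set.Icc 0 T) :=
        measureReal_mono (Set.inter_subset_inter_left _ hA)
          (measure_ne_top_of_subset Set.inter_subset_right (by simp))
    _ = ∫ δ in Set.Icc 0 T, B.indicator (fun _ => (1 : ℝ)) δ := by
        rw [setIntegral_indicator hBm, setIntegral_const, smul_eq_mul, mul_one, Set.inter_comm]
    _ ≤ ∫ δ in Set.Icc 0 T, g (S δ) := by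
        refine integral_mono_of_nonneg
          (ae_of_all _ fun δ => Set.indicator_nonneg (fun _ _ => zero_le_one) _)
          (g.continuous.comp hS).integrableOn_Icc (ae_of_all _ fun δ => ?_)
        refine Set.indicator_le' (fun δ hδ => hgη _ hδ) (fun δ _ => hg0 _) δ
    _ = ∫ δ in (0 : ℝ)..T, g (S δ) := by
        rw [integral_Icc_eq_integral_Ioc, intervalIntegral.integral_of_le hT0.le]

theorem upperCesaroDensity_le_of_isCesaroPDF {S : ℝ → ℝ} (hS : Continuous S) {f : ℝ →ᵇ ℝ}
    (hf : IsCesaroPDF S f) {η : ℝ} (hη : 0 ≤ η) {A : Set ℝ} (hA : A ⊆ {δ | |S δ| ≤ η}) :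
    upperCesaroDensity A ≤ 2 * ‖f‖ * η := by
  -- A real `limsup` is meaningful only with a bound from below, here zero.
  have hcob : IsCoboundedUnder (· ≤ ·) atTop fun T : ℝ => volume.real (A ∩ Set.Icc 0 T) / T := by
    refine IsCoboundedUnder.of_frequently_ge (a := 0) (Eventually.frequently ?_)
    filter_upwards [eventually_gt_atTop 0] with T hT
    positivity
  have hlim : Tendsto (fun ε : ℝ => 2 * ‖f‖ * (η + ε) + ε) (𝓝[>] 0) (𝓝 (2 * ‖f‖ * η)) := by
    have : Continuous fun ε : ℝ => 2 * ‖f‖ * (η + ε) + ε := by fun_prop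
    have h := (this.tendsto 0).mono_left (nhdsWithin_le_nhds (s := Set.Ioi 0))
    simpa using h
  refine ge_of_tendsto hlim ?_
  filter_upwards [self_mem_nhdsWithin] with ε hε
  exact limsup_le_of_le hcob (eventually_volume_real_div_le hS hf hη hA hε)

theorem HasCesaroDensity.upperCesaroDensity_eq {A : Set ℝ} {D : ℝ} (h : HasCesaroDensity A D) :
    upperCesaroDensity A = D :=
  Tendsto.limsup_eq h

end CesaroDistribution

/-! ### Growth of completed zeta functions -/

section Growth

open Real

/-- Functions on `ℂ` of growth at most `exp (K (1 + ‖s‖) ^ (3 / 2))`. -/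
def HasThreeHalvesGrowth (f : ℂ → ℂ) : Prop :=
  ∃ K : ℝ, 0 ≤ K ∧ ∀ s, ‖f s‖ ≤ Real.exp (K * (1 + ‖s‖) ^ (3 / 2 : ℝ))

namespace HasThreeHalvesGrowth

theorem one_add_norm_le (s : ℂ) : 1 + ‖s‖ ≤ (1 + ‖s‖) ^ (3 / 2 : ℝ) :=
  Real.self_le_rpow_of_one_le (by linarith [norm_nonneg s]) (by norm_num)

theorem of_norm_le_exp_linear {f : ℂ → ℂ} {K : ℝ} (hK : 0 ≤ K)
    (h : ∀ s, ‖f s‖ ≤ Real.exp (K * (1 + ‖s‖))) : HasThreeHalvesGrowth f :=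
  ⟨K, hK, fun s => (h s).trans (Real.exp_le_exp.mpr
    (mul_le_mul_of_nonneg_left (one_add_norm_le s) hK))⟩

theorem const (c : ℂ) : HasThreeHalvesGrowth fun _ => c := by
  refine of_norm_le_exp_linear (K := ‖c‖) (norm_nonneg c) fun s => ?_
  have h1 := Real.add_one_le_exp (‖c‖ * (1 + ‖s‖))
  have h2 : 0 ≤ ‖c‖ * ‖s‖ := by positivity
  linarith

theorem id : HasThreeHalvesGrowth fun s => s := by
  refine of_norm_le_exp_linear zero_le_one fun s => ?_
  have h1 := Real.add_one_le_exp (1 * (1 + ‖s‖))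
  linarith

theorem mul {f g : ℂ → ℂ} (hf : HasThreeHalvesGrowth f) (hg : HasThreeHalvesGrowth g) :
    HasThreeHalvesGrowth fun s => f s * g s := by
  obtain ⟨K, hK, hf⟩ := hf
  obtain ⟨L, hL, hg⟩ := hg
  refine ⟨K + L, add_nonneg hK hL, fun s => ?_⟩
  rw [norm_mul, add_mul, Real.exp_add]
  exact mul_le_mul (hf s) (hg s) (norm_nonneg _) (Real.exp_pos _).le

theorem add {f g : ℂ → ℂ} (hf : HasThreeHalvesGrowth f) (hg : HasThreeHalvesGrowth g) :
    HasThreeHalvesGrowth fun s => f s + g s := by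
  obtain ⟨K, hK, hf⟩ := hf
  obtain ⟨L, hL, hg⟩ := hg
  refine ⟨K + L + 1, by positivity, fun s => ?_⟩
  set x := (1 + ‖s‖) ^ (3 / 2 : ℝ) with hx
  have hx1 : 1 ≤ x := (by linarith [norm_nonneg s] : 1 ≤ 1 + ‖s‖).trans (one_add_norm_le s)
  have hx0 : 0 ≤ x := zero_le_one.trans hx1
  have hKx : 0 ≤ K * x := by positivity
  have hLx : 0 ≤ L * x := by positivity
  have h1 : Real.exp (K * x) ≤ Real.exp (K * x + L * x) := Real.exp_le_exp.mpr (by linarith)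
  have h2 : Real.exp (L * x) ≤ Real.exp (K * x + L * x) := Real.exp_le_exp.mpr (by linarith)
  have h3 : (2 : ℝ) ≤ Real.exp x := by linarith [Real.add_one_le_exp x]
  calc ‖f s + g s‖ ≤ ‖f s‖ + ‖g s‖ := norm_add_le _ _
    _ ≤ Real.exp (K * x + L * x) * 2 := by linarith [hf s, hg s]
    _ ≤ Real.exp (K * x + L * x) * Real.exp x := by gcongr
    _ = Real.exp ((K + L + 1) * x) := by rw [← Real.exp_add]; ring_nf

theorem sum {ι : Type*} (t : Finset ι) {f : ι → ℂ → ℂ} (hf : ∀ i, HasThreeHalvesGrowth (f i)) :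
    HasThreeHalvesGrowth fun s => ∑ i ∈ t, f i s := by
  classical
  induction t using Finset.induction_on with
  | empty => simpa using const 0
  | insert a t ha ih => simpa only [Finset.sum_insert ha] using (hf a).add ih

theorem comp_div_two {f : ℂ → ℂ} (hf : HasThreeHalvesGrowth f) :
    HasThreeHalvesGrowth fun s => f (s / 2) := by
  obtain ⟨K, hK, hf⟩ := hf
  refine ⟨K, hK, fun s => (hf (s / 2)).trans ?_⟩
  have : ‖s / 2‖ ≤ ‖s‖ := by
    rw [norm_div, Complex.norm_ofNat]
    linarith [norm_nonneg s]
  gcongr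

theorem natCast_cpow_neg (N : ℕ) [NeZero N] : HasThreeHalvesGrowth fun s => (N : ℂ) ^ (-s) := by
  have hN : 0 < N := Nat.pos_of_ne_zero (NeZero.ne N)
  have hlog : 0 ≤ Real.log N := Real.log_natCast_nonneg N
  refine of_norm_le_exp_linear hlog fun s => ?_
  rw [Complex.norm_natCast_cpow_of_pos hN, Real.rpow_def_of_pos (by exact_mod_cast hN)]
  have h1 : (-s).re ≤ 1 + ‖s‖ := by
    have := Complex.re_le_norm (-s)
    rw [norm_neg] at this
    linarith
  gcongr

end HasThreeHalvesGrowth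

/-- The function `x ^ a * exp (-p x / 2)` peaks at `x = 2a/p`; the factor `exp (-a)` in its maximum
is discarded. -/
theorem rpow_le_mul_exp {p a x : ℝ} (hp : 0 < p) (ha : 0 < a) (hx : 0 < x) :
    x ^ a ≤ (2 * a / p) ^ a * Real.exp (p / 2 * x) := by
  have h1 : 0 < 2 * a / p := by positivity
  have h2 : x = 2 * a / p * (p * x / (2 * a)) := by field_simp
  have h3 : 0 < p * x / (2 * a) := by positivity
  conv_lhs => rw [h2]
  rw [Real.mul_rpow h1.le h3.le]
  refine mul_le_mul_of_nonneg_left ?_ (by positivity)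
  rw [Real.rpow_def_of_pos h3]
  refine Real.exp_le_exp.mpr ?_
  calc Real.log (p * x / (2 * a)) * a ≤ (p * x / (2 * a)) * a := by
        gcongr
        exact (Real.log_le_sub_one_of_pos h3).trans (by linarith)
    _ = p / 2 * x := by field_simp

/-- The inequality `log y ≤ 2√y` absorbs the logarithm in `a log a`. The resulting exponent `3/2` is
below 2, as the inverse-square sum over zeros requires. -/
theorem rpow_self_le_exp {p a : ℝ} (hp : 0 < p) (ha : 0 < a) :
    (2 * a / p) ^ a ≤ Real.exp (2 * √(2 / p) * a ^ (3 / 2 : ℝ)) := by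
  have h1 : 0 < 2 * a / p := by positivity
  rw [Real.rpow_def_of_pos h1]
  refine Real.exp_le_exp.mpr ?_
  have h2 := Real.log_le_rpow_div h1.le (ε := 1 / 2) (by norm_num)
  rw [← Real.sqrt_eq_rpow] at h2
  have h3 : √(2 * a / p) = √(2 / p) * √a := by
    rw [← Real.sqrt_mul (by positivity)]
    congr 1
    ring
  have h4 : a ^ (3 / 2 : ℝ) = √a * a := by
    rw [Real.sqrt_eq_rpow]
    nth_rewrite 3 [← Real.rpow_one a]
    rw [← Real.rpow_add ha]
    norm_num
  calc Real.log (2 * a / p) * a ≤ √(2 * a / p) / (1 / 2) * a := by gcongr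
    _ = 2 * √(2 / p) * a ^ (3 / 2 : ℝ) := by rw [h3, h4]; ring

/-- The Mellin transform of a function decaying exponentially at `∞` and like `exp (-p / x)`
at `0` has order at most `3 / 2`. -/
theorem hasThreeHalvesGrowth_mellin {h : ℝ → ℂ} {C p k : ℝ} (hC : 0 ≤ C) (hp : 0 < p) (hk : 0 ≤ k)
    (h_top : ∀ x, 1 < x → ‖h x‖ ≤ C * Real.exp (-p * x))
    (h_zero : ∀ x, 0 < x → x < 1 → ‖h x‖ ≤ C * x ^ (-k) * Real.exp (-p * x⁻¹)) :
    HasThreeHalvesGrowth (mellin h) := by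
  set I : ℝ := ∫ x in Set.Ioi (0 : ℝ), Real.exp (p / 2) * Real.exp (-(p / 2) * x) with hI
  have hI0 : 0 ≤ I := integral_nonneg fun x => by positivity
  have hint : IntegrableOn (fun x : ℝ => Real.exp (p / 2) * Real.exp (-(p / 2) * x))
      (Set.Ioi 0) := (exp_neg_integrableOn_Ioi 0 (by positivity)).const_mul _
  have key : ∀ s : ℂ, ‖mellin h s‖ ≤
      C * I * Real.exp (2 * √(2 / p) * (‖s‖ + k + 1) ^ (3 / 2 : ℝ)) := by
    intro s
    -- This exponent dominates the power of `x` at infinity and of `1/x` at zero. Half of the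
    -- exponential decay pays for the power; the other half keeps the integral finite.
    set a := ‖s‖ + k + 1 with ha
    have ha0 : 0 < a := by positivity
    set B := (2 * a / p) ^ a with hB
    have hB0 : 0 ≤ B := by positivity
    have hbound : ‖mellin h s‖ ≤ ∫ x in Set.Ioi (0 : ℝ),
        C * B * (Real.exp (p / 2) * Real.exp (-(p / 2) * x)) := by
      refine norm_integral_le_of_norm_le (hint.const_mul _) ?_
      have hne : ∀ᵐ x : ℝ, x ≠ 1 := by simp [ae_iff]
      filter_upwards [ae_restrict_mem measurableSet_Ioi, ae_restrict_of_ae hne] with x hx hx1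
      have hx0 : (0 : ℝ) < x := hx
      rw [norm_smul, Complex.norm_cpow_eq_rpow_re_of_pos hx0, Complex.sub_re, Complex.one_re]
      rcases lt_or_gt_of_ne hx1 with hlt | hgt
      · have hinv : 1 ≤ x⁻¹ := (one_le_inv₀ hx0).mpr hlt.le
        have h1 : x ^ (s.re - 1) * x ^ (-k) ≤ x⁻¹ ^ a := by
          rw [← Real.rpow_add hx0, Real.inv_rpow hx0.le, ← Real.rpow_neg hx0.le]
          refine Real.rpow_le_rpow_of_exponent_ge hx0 hlt.le ?_
          have := (abs_le.mp (Complex.abs_re_le_norm s)).1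
          linarith
        have h2 := rpow_le_mul_exp hp ha0 (inv_pos.mpr hx0)
        calc x ^ (s.re - 1) * ‖h x‖
            ≤ x ^ (s.re - 1) * (C * x ^ (-k) * Real.exp (-p * x⁻¹)) := by
              gcongr
              exact h_zero x hx0 hlt
          _ = C * (x ^ (s.re - 1) * x ^ (-k)) * Real.exp (-p * x⁻¹) := by ring
          _ ≤ C * (B * Real.exp (p / 2 * x⁻¹)) * Real.exp (-p * x⁻¹) := by
              gcongr C * ?_ * _
              exact h1.trans h2
          _ = C * B * Real.exp (-(p / 2) * x⁻¹) := by
              rw [mul_assoc, mul_assoc, ← Real.exp_add]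
              ring_nf
          _ ≤ C * B * (Real.exp (p / 2) * Real.exp (-(p / 2) * x)) := by
              rw [← Real.exp_add]
              gcongr
              have : p / 2 * x ≤ p / 2 * 1 := by gcongr
              have h5 : 0 ≤ p / 2 * x⁻¹ := by positivity
              linarith
      · have h1 : x ^ (s.re - 1) ≤ x ^ a := by
          refine Real.rpow_le_rpow_of_exponent_le hgt.le ?_
          have := Complex.re_le_norm s
          linarith
        have h2 := rpow_le_mul_exp hp ha0 hx0
        calc x ^ (s.re - 1) * ‖h x‖
            ≤ (B * Real.exp (p / 2 * x)) * (C * Real.exp (-p * x)) := by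
              gcongr
              · exact h1.trans h2
              · exact h_top x hgt
          _ = C * B * (1 * Real.exp (-(p / 2) * x)) := by
              have : Real.exp (-(p / 2) * x) = Real.exp (p / 2 * x) * Real.exp (-p * x) := by
                rw [← Real.exp_add]
                ring_nf
              rw [this]
              ring
          _ ≤ C * B * (Real.exp (p / 2) * Real.exp (-(p / 2) * x)) := by
              gcongr
              exact Real.one_le_exp (by positivity)
    rw [integral_const_mul, ← hI] at hbound
    calc ‖mellin h s‖ ≤ C * B * I := hbound
      _ = C * I * B := by ring
      _ ≤ _ := by
        gcongr
        exact rpow_self_le_exp hp ha0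
  have hmain : HasThreeHalvesGrowth fun s =>
      ((C * I : ℝ) : ℂ) * ((Real.exp (2 * √(2 / p) * (‖s‖ + k + 1) ^ (3 / 2 : ℝ)) : ℝ) : ℂ) := by
    refine (HasThreeHalvesGrowth.const _).mul ⟨2 * √(2 / p) * (k + 1) ^ (3 / 2 : ℝ),
      by positivity, fun s => ?_⟩
    rw [Complex.norm_real, Real.norm_of_nonneg (Real.exp_pos _).le, mul_assoc _ (_ ^ _),
      ← Real.mul_rpow (by positivity) (by positivity)]
    gcongr
    have : 0 ≤ k * ‖s‖ := by positivity
    linarith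
  obtain ⟨K, hK, hle⟩ := hmain
  refine ⟨K, hK, fun s => (key s).trans (le_trans (le_of_eq ?_) (hle s))⟩
  rw [norm_mul, Complex.norm_real, Complex.norm_real, Real.norm_of_nonneg (by positivity),
    Real.norm_of_nonneg (Real.exp_pos _).le]

theorem exists_forall_le_exp_of_isBigO {h : ℝ → ℝ} (hc : ContinuousOn h (Set.Ioi 0)) {p : ℝ}
    (hO : h =O[atTop] fun x => Real.exp (-p * x)) :
    ∃ C, 0 ≤ C ∧ ∀ x, 1 ≤ x → |h x| ≤ C * Real.exp (-p * x) := by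
  obtain ⟨c, hc0, hcO⟩ := hO.exists_nonneg
  obtain ⟨R, hR⟩ := eventually_atTop.mp hcO.bound
  obtain ⟨B, hB⟩ := isCompact_Icc.exists_bound_of_continuousOn (s := Set.Icc 1 R)
    (f := fun x => h x * Real.exp (p * x))
    ((hc.mono fun x hx => one_pos.trans_le hx.1).mul (by fun_prop))
  refine ⟨max c B, le_max_of_le_left hc0, fun x hx => ?_⟩
  rcases le_total R x with h1 | h1
  · have := hR x h1
    rw [Real.norm_eq_abs, Real.norm_of_nonneg (Real.exp_pos _).le] at this
    exact this.trans (by gcongr; exact le_max_left _ _)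
  · have := hB x ⟨hx, h1⟩
    rw [norm_mul, Real.norm_of_nonneg (Real.exp_pos _).le, Real.norm_eq_abs] at this
    calc |h x| = |h x| * Real.exp (p * x) * Real.exp (-p * x) := by
          rw [mul_assoc, ← Real.exp_add]; simp
      _ ≤ max c B * Real.exp (-p * x) := by
          gcongr
          exact this.trans (le_max_right _ _)

open HurwitzZeta in
-- This function is half a Mellin transform, at `s/2`, of a theta kernel with its singular terms
-- removed. Decay at infinity is direct; near zero the functional equation of the kernel exchanges
-- `x` and `1/x`, at the cost of `x^(-1/2)`.
theorem hasThreeHalvesGrowth_completedHurwitzZetaEven₀ (a : UnitAddCircle) :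
    HasThreeHalvesGrowth (completedHurwitzZetaEven₀ a) := by
  obtain ⟨p, hp, hpO⟩ := isBigO_atTop_evenKernel_sub a
  obtain ⟨q, hq, hqO⟩ := isBigO_atTop_cosKernel_sub a
  obtain ⟨C, hC, hCx⟩ := exists_forall_le_exp_of_isBigO
    ((continuousOn_evenKernel a).sub continuousOn_const) hpO
  obtain ⟨D, hD, hDx⟩ := exists_forall_le_exp_of_isBigO
    ((continuousOn_cosKernel a).sub continuousOn_const) hqO
  have hmellin : HasThreeHalvesGrowth (mellin (hurwitzEvenFEPair a).f_modif) := by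
    refine hasThreeHalvesGrowth_mellin (C := max C D) (p := min p q) (k := 1 / 2)
      (le_max_of_le_left hC) (lt_min hp hq) (by norm_num) (fun x hx => ?_) fun x hx0 hx1 => ?_
    · have h1 : (hurwitzEvenFEPair a).f_modif x =
          ((evenKernel a x - if a = 0 then 1 else 0 : ℝ) : ℂ) := by
        rw [WeakFEPair.f_modif, Pi.add_apply, Set.indicator_of_mem (Set.mem_Ioi.mpr hx),
          Set.indicator_of_notMem (fun h => by linarith [h.2]), add_zero]
        simp only [hurwitzEvenFEPair, Function.comp_apply]
        push_cast
        split_ifs <;> simp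
      rw [h1, Complex.norm_real, Real.norm_eq_abs]
      refine (hCx x hx.le).trans ?_
      gcongr
      · exact le_max_left _ _
      · exact min_le_left _ _
    · have h1 : (hurwitzEvenFEPair a).f_modif x =
          ((x ^ (-(1 / 2) : ℝ) * (cosKernel a x⁻¹ - 1) : ℝ) : ℂ) := by
        rw [WeakFEPair.f_modif, Pi.add_apply, Set.indicator_of_notMem (by simpa using hx1.le),
          Set.indicator_of_mem (Set.mem_Ioo.mpr ⟨hx0, hx1⟩), zero_add]
        simp only [hurwitzEvenFEPair, Function.comp_apply]
        rw [evenKernel_functional_equation, Real.rpow_neg hx0.le, one_div x]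
        simp only [smul_eq_mul]
        push_cast
        ring
      rw [h1, Complex.norm_real, Real.norm_eq_abs, abs_mul, abs_of_pos (by positivity)]
      have hinv : 1 ≤ x⁻¹ := (one_le_inv₀ hx0).mpr hx1.le
      calc x ^ (-(1 / 2) : ℝ) * |cosKernel a x⁻¹ - 1|
          ≤ x ^ (-(1 / 2) : ℝ) * (D * Real.exp (-q * x⁻¹)) := by
            gcongr
            exact hDx _ hinv
        _ ≤ x ^ (-(1 / 2) : ℝ) * (max C D * Real.exp (-min p q * x⁻¹)) := by
            gcongr
            · exact le_max_right _ _
            · exact min_le_right _ _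
        _ = _ := by ring
  have h2 : completedHurwitzZetaEven₀ a =
      fun s => mellin (hurwitzEvenFEPair a).f_modif (s / 2) * (2 : ℂ)⁻¹ := by
    ext s
    rw [completedHurwitzZetaEven₀, WeakFEPair.Λ₀, div_eq_mul_inv]
  rw [h2]
  exact hmellin.comp_div_two.mul (HasThreeHalvesGrowth.const _)

end Growth

/-! ### Jensen's formula and summability over zeros -/

section ZeroCounting

open Real

theorem divisor_eq_analyticOrderNatAt {G : ℂ → ℂ} (hG : Differentiable ℂ G) {U : Set ℂ} {z : ℂ}
    (hz : z ∈ U) : MeromorphicOn.divisor G U z = (analyticOrderNatAt G z : ℤ) := by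
  have hm : MeromorphicOn G U := fun w _ => (hG.analyticAt w).meromorphicAt
  rw [MeromorphicOn.divisor_apply hm hz, (hG.analyticAt z).meromorphicOrderAt_eq,
    analyticOrderNatAt]
  cases analyticOrderAt G z with
  | top => simp
  | coe n => simp

/-- Jensen's bound for the number of zeros of an entire function of order at most `3 / 2`. -/
theorem exists_sum_analyticOrderNatAt_le {G : ℂ → ℂ} (hG : Differentiable ℂ G)
    (hgr : HasThreeHalvesGrowth G) {c : ℂ} (hc : G c ≠ 0) :
    ∃ C, 0 ≤ C ∧ ∀ r : ℝ, 1 ≤ r → ∀ Z : Finset ℂ, (∀ z ∈ Z, ‖z - c‖ ≤ r) →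
      ∑ z ∈ Z, (analyticOrderNatAt G z : ℝ) ≤ C * r ^ (3 / 2 : ℝ) := by
  classical
  obtain ⟨K, hK, hKs⟩ := hgr
  have hlog2 : 0 < Real.log 2 := Real.log_pos one_lt_two
  refine ⟨(K * (‖c‖ + 3) ^ (3 / 2 : ℝ) + |Real.log ‖G c‖|) / Real.log 2, by positivity,
    fun r hr Z hZ => ?_⟩
  have hr0 : 0 < r := one_pos.trans_le hr
  -- On a disc of twice the radius, each zero within `r` of `c` contributes at least `log 2` to
  -- Jensen's formula.
  set R := 2 * r with hR
  have hR0 : 0 < R := by positivity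
  have hm : MeromorphicOn G (Metric.closedBall c |R|) :=
    fun w _ => (hG.analyticAt w).meromorphicAt
  have hm' : MeromorphicOn G (Metric.sphere c |R|) :=
    fun w _ => (hG.analyticAt w).meromorphicAt
  set div := MeromorphicOn.divisor G (Metric.closedBall c |R|) with hdiv
  have hdivz : ∀ z ∈ Metric.closedBall c |R|, div z = (analyticOrderNatAt G z : ℤ) := fun z hz =>
    divisor_eq_analyticOrderNatAt hG hz
  have hdivc : div c = 0 := by
    rw [hdivz c (Metric.mem_closedBall_self (abs_nonneg R)), analyticOrderNatAt,
      (hG.analyticAt c).analyticOrderAt_eq_zero.mpr hc]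
    rfl
  have htrail : meromorphicTrailingCoeffAt G c = G c :=
    (hG.analyticAt c).meromorphicTrailingCoeffAt_of_ne_zero hc
  have hjensen := MeromorphicOn.circleAverage_log_norm hR0.ne' hm
  rw [← hdiv, hdivc, htrail] at hjensen
  have hupper : Real.circleAverage (fun x => Real.log ‖G x‖) c R ≤
      K * (‖c‖ + 3) ^ (3 / 2 : ℝ) * r ^ (3 / 2 : ℝ) := by
    refine Real.circleAverage_mono_on_of_le_circle
      (MeromorphicOn.circleIntegrable_log_norm hm') fun x hx => ?_
    rw [mul_assoc, ← Real.mul_rpow (by positivity) hr0.le]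
    have hxn : 1 + ‖x‖ ≤ (‖c‖ + 3) * r := by
      rw [mem_sphere_iff_norm, abs_of_pos hR0] at hx
      have h1 : ‖x‖ ≤ ‖c‖ + ‖x - c‖ := by
        have := norm_add_le c (x - c)
        rwa [add_sub_cancel] at this
      have h2 : ‖c‖ * 1 ≤ ‖c‖ * r := by gcongr
      linarith
    -- At a zero on the circle the convention `log 0 = 0` keeps the bound true.
    by_cases h0 : G x = 0
    · simp only [h0, norm_zero, Real.log_zero]
      positivity
    · calc Real.log ‖G x‖ ≤ Real.log (Real.exp (K * (1 + ‖x‖) ^ (3 / 2 : ℝ))) :=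
            Real.log_le_log (norm_pos_iff.mpr h0) (hKs x)
        _ = K * (1 + ‖x‖) ^ (3 / 2 : ℝ) := Real.log_exp _
        _ ≤ _ := by gcongr
  have hfin : (Function.support fun u => (div u : ℝ) * Real.log (R * ‖c - u‖⁻¹)).Finite := by
    refine (div.finiteSupport (isCompact_closedBall c |R|)).subset fun u hu => ?_
    rw [Function.mem_support] at hu ⊢
    rintro h
    exact hu (by rw [h]; simp)
  have hlower : Real.log 2 * ∑ z ∈ Z, (analyticOrderNatAt G z : ℝ) ≤
      ∑ᶠ u, (div u : ℝ) * Real.log (R * ‖c - u‖⁻¹) := by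
    rw [finsum_eq_sum_of_support_subset (s := hfin.toFinset ∪ Z) _ fun u hu =>
      Finset.mem_coe.mpr (Finset.mem_union_left _ (hfin.mem_toFinset.mpr hu)), Finset.mul_sum]
    have hterm : ∀ u, 0 ≤ (div u : ℝ) * Real.log (R * ‖c - u‖⁻¹) := by
      intro u
      by_cases hu : u ∈ Metric.closedBall c |R|
      · rw [hdivz u hu]
        refine mul_nonneg (by positivity) ?_
        rcases eq_or_ne u c with rfl | huc
        · simp
        · have h1 : 0 < ‖c - u‖ := norm_pos_iff.mpr (sub_ne_zero.mpr huc.symm)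
          refine Real.log_nonneg ?_
          rw [← div_eq_mul_inv, le_div_iff₀ h1, one_mul, ← dist_eq_norm, dist_comm]
          rwa [Metric.mem_closedBall, abs_of_pos hR0] at hu
      · rw [div.apply_eq_zero_of_notMem hu]
        simp
    refine le_trans (Finset.sum_le_sum fun z hz => ?_)
      (Finset.sum_le_sum_of_subset_of_nonneg Finset.subset_union_right fun u _ _ => hterm u)
    have hzr := hZ z hz
    have hzb : z ∈ Metric.closedBall c |R| := by
      rw [mem_closedBall_iff_norm, abs_of_pos hR0]
      linarith
    rcases eq_or_ne z c with rfl | hzc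
    · have := hdivz z hzb
      rw [hdivc] at this
      have h0 : analyticOrderNatAt G z = 0 := by exact_mod_cast this.symm
      simp [h0]
    · rw [hdivz z hzb, mul_comm]
      push_cast
      refine mul_le_mul_of_nonneg_left ?_ (by positivity)
      have h1 : 0 < ‖c - z‖ := norm_pos_iff.mpr (sub_ne_zero.mpr hzc.symm)
      refine Real.log_le_log two_pos ?_
      rw [← div_eq_mul_inv, le_div_iff₀ h1, norm_sub_rev]
      linarith
  have hr1 : 1 ≤ r ^ (3 / 2 : ℝ) := Real.one_le_rpow hr (by norm_num)
  have hlogc : -Real.log ‖G c‖ ≤ |Real.log ‖G c‖| * r ^ (3 / 2 : ℝ) :=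
    (neg_le_abs _).trans (le_mul_of_one_le_right (abs_nonneg _) hr1)
  rw [div_mul_eq_mul_div, le_div_iff₀ hlog2, mul_comm _ (Real.log 2), add_mul]
  push_cast at hjensen
  linarith

/-- Zeros of an entire function of order at most `3 / 2` are summable with inverse square weight. -/
theorem exists_sum_analyticOrderNatAt_div_sq_le {G : ℂ → ℂ} (hG : Differentiable ℂ G)
    (hgr : HasThreeHalvesGrowth G) {c : ℂ} (hc : G c ≠ 0) :
    ∃ C, ∀ Z : Finset ℂ, (∀ z ∈ Z, 1 ≤ ‖z - c‖) →
      ∑ z ∈ Z, (analyticOrderNatAt G z : ℝ) / ‖z - c‖ ^ 2 ≤ C := by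
  classical
  obtain ⟨C, hC, hCr⟩ := exists_sum_analyticOrderNatAt_le hG hgr hc
  -- Ratio of the dyadic sum: the shell `|z - c| ≈ 2^i` carries `O(2^(3i/2))` zeros of weight at
  -- most `4^(-i)`.
  set q : ℝ := 2 ^ (3 / 2 : ℝ) / 4 with hq
  have hq0 : 0 ≤ q := by positivity
  have hq1 : q < 1 := by
    rw [hq, div_lt_one (by norm_num)]
    calc (2 : ℝ) ^ (3 / 2 : ℝ) < 2 ^ (2 : ℝ) :=
          Real.rpow_lt_rpow_of_exponent_lt one_lt_two (by norm_num)
      _ = 4 := by norm_num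
  refine ⟨C * 2 ^ (3 / 2 : ℝ) * (1 - q)⁻¹, fun Z hZ => ?_⟩
  set j : ℂ → ℕ := fun z => Nat.log 2 ⌊‖z - c‖⌋₊ with hj
  have hjl : ∀ z ∈ Z, (2 : ℝ) ^ j z ≤ ‖z - c‖ := fun z hz => by
    have h1 : ⌊‖z - c‖⌋₊ ≠ 0 := (Nat.floor_pos.mpr (hZ z hz)).ne'
    have h2 : ((2 ^ j z : ℕ) : ℝ) ≤ (⌊‖z - c‖⌋₊ : ℝ) := by
      exact_mod_cast Nat.pow_log_le_self 2 h1
    push_cast at h2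
    exact h2.trans (Nat.floor_le (norm_nonneg _))
  have hju : ∀ z ∈ Z, ‖z - c‖ ≤ (2 : ℝ) ^ (j z + 1) := fun z hz => by
    have h1 : ⌊‖z - c‖⌋₊ + 1 ≤ 2 ^ (j z + 1) := Nat.lt_pow_succ_log_self one_lt_two _
    have h2 : ((⌊‖z - c‖⌋₊ : ℝ) + 1) ≤ (2 : ℝ) ^ (j z + 1) := by exact_mod_cast h1
    exact (Nat.lt_floor_add_one _).le.trans h2
  obtain ⟨J, hJ⟩ : ∃ J, ∀ z ∈ Z, j z ∈ Finset.range J :=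
    ⟨Z.sup j + 1, fun z hz => Finset.mem_range.mpr (Nat.lt_succ_of_le (Finset.le_sup hz))⟩
  rw [← Finset.sum_fiberwise_of_maps_to hJ]
  calc ∑ i ∈ Finset.range J, ∑ z ∈ Z with j z = i, (analyticOrderNatAt G z : ℝ) / ‖z - c‖ ^ 2
      ≤ ∑ i ∈ Finset.range J, C * 2 ^ (3 / 2 : ℝ) * q ^ i := by
        refine Finset.sum_le_sum fun i _ => ?_
        have h1 := hCr ((2 : ℝ) ^ (i + 1)) (one_le_pow₀ one_le_two) (Z.filter fun z => j z = i)
          fun z hz => by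
            obtain ⟨hzZ, rfl⟩ := Finset.mem_filter.mp hz
            exact hju z hzZ
        calc ∑ z ∈ Z with j z = i, (analyticOrderNatAt G z : ℝ) / ‖z - c‖ ^ 2
            ≤ ∑ z ∈ Z with j z = i, (analyticOrderNatAt G z : ℝ) / (2 ^ i) ^ 2 := by
              refine Finset.sum_le_sum fun z hz => ?_
              obtain ⟨hzZ, rfl⟩ := Finset.mem_filter.mp hz
              gcongr
              exact hjl z hzZ
          _ = (∑ z ∈ Z with j z = i, (analyticOrderNatAt G z : ℝ)) / 4 ^ i := by
              rw [Finset.sum_div, ← pow_mul, mul_comm i 2, pow_mul]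
              norm_num
          _ ≤ C * ((2 : ℝ) ^ (i + 1)) ^ (3 / 2 : ℝ) / 4 ^ i := by gcongr
          _ = C * 2 ^ (3 / 2 : ℝ) * q ^ i := by
              rw [hq, div_pow, ← Real.rpow_pow_comm two_pos.le, pow_succ]
              ring
    _ ≤ C * 2 ^ (3 / 2 : ℝ) * (1 - q)⁻¹ := by
        rw [← Finset.mul_sum]
        gcongr
        rw [← tsum_geometric_of_lt_one hq0 hq1]
        exact (summable_geometric_of_lt_one hq0 hq1).sum_le_tsum _ fun i _ => by positivity

theorem lorentzWeight_pos {z : ℂ} (h0 : 0 < z.re) (h1 : z.re < 1) : 0 < lorentzWeight z := by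
  have h2 : 0 < z.re * (1 - z.re) := mul_pos h0 (by linarith)
  unfold lorentzWeight
  positivity

/-- Dropping the second square leaves `2/A`. In the strip, `|z - 2| > 3` forces `γ² > 5`, hence `|z
- 2|² ≤ 4 + γ² ≤ 2A`. -/
theorem lorentzWeight_le {z : ℂ} (h0 : 0 < z.re) (h1 : z.re < 1) (hz : 3 < ‖z - 2‖) :
    lorentzWeight z ≤ 4 / ‖z - 2‖ ^ 2 := by
  have h2 : 0 < z.re * (1 - z.re) := mul_pos h0 (by linarith)
  have h3 : ‖z - 2‖ ^ 2 = (z.re - 2) ^ 2 + z.im ^ 2 := by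
    rw [Complex.sq_norm, Complex.normSq_apply]
    simp
    ring
  have h4 : 9 < ‖z - 2‖ ^ 2 := by nlinarith
  have h5 : (z.re - 2) ^ 2 ≤ 4 := by nlinarith
  have h6 : 0 < z.im ^ 2 := by linarith
  set A := z.re * (1 - z.re) + z.im ^ 2 with hA
  have hA0 : 0 < A := by positivity
  calc lorentzWeight z ≤ 2 * A / A ^ 2 := by
        unfold lorentzWeight
        gcongr
        rw [← hA]
        have : 0 ≤ 4 * z.im ^ 2 * (1 / 2 - z.re) ^ 2 := by positivity
        linarith
    _ = 2 / A := by field_simp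
    _ ≤ 4 / ‖z - 2‖ ^ 2 := by
        rw [div_le_div_iff₀ hA0 (by linarith)]
        linarith

/-- Weighted zero sums converge for a function which, in the critical strip, is a nonvanishing
multiple of an entire function of order at most `3 / 2`. -/
theorem summable_lorentzWeight {F G : ℂ → ℂ} (hG : Differentiable ℂ G)
    (hgr : HasThreeHalvesGrowth G) (hG2 : G 2 ≠ 0)
    (hord : ∀ z ∈ upperZeros F, analyticOrderAt F z = analyticOrderAt G z) :
    Summable fun z : upperZeros F => (analyticOrderNatAt F z : ℝ) * lorentzWeight z := by
  obtain ⟨C, hC⟩ := exists_sum_analyticOrderNatAt_div_sq_le hG hgr hG2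
  have hnat : ∀ z : upperZeros F, analyticOrderNatAt F z = analyticOrderNatAt G z := fun z => by
    rw [analyticOrderNatAt, analyticOrderNatAt, hord z z.2]
  have hfar : ∀ z : upperZeros F, 1 ≤ ‖(z : ℂ) - 2‖ := fun z => by
    have h1 := Complex.abs_re_le_norm ((z : ℂ) - 2)
    have h2 : ((z : ℂ) - 2).re = (z : ℂ).re - 2 := by simp
    rw [h2] at h1
    have h3 := neg_le_abs ((z : ℂ).re - 2)
    linarith [z.2.2.2.1]
  have hsum : Summable fun z : upperZeros F =>
      (analyticOrderNatAt G z : ℝ) / ‖(z : ℂ) - 2‖ ^ 2 := by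
    refine summable_of_sum_le (c := C) (fun z => by positivity) fun Z => ?_
    have := hC (Z.map (Function.Embedding.subtype _)) (by
      intro z hz
      obtain ⟨w, -, rfl⟩ := Finset.mem_map.mp hz
      exact hfar w)
    rwa [Finset.sum_map] at this
  refine Summable.of_norm_bounded_eventually (hsum.mul_left 4) ?_
  -- All but finitely many terms are below `1/9`; as a zero has order at least one (order zero being
  -- trivial), this forces `|z - 2| > 3`.
  filter_upwards [hsum.tendsto_cofinite_zero.eventually
    (eventually_lt_nhds (b := 1 / 9) (by norm_num))] with z hz
  rw [Real.norm_of_nonneg (mul_nonneg (by positivity)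
    (lorentzWeight_pos z.2.2.1 z.2.2.2.1).le), hnat z]
  rcases Nat.eq_zero_or_pos (analyticOrderNatAt G z) with h0 | h0
  · simp [h0]
  · have h1 : (1 : ℝ) ≤ analyticOrderNatAt G z := by exact_mod_cast h0
    have h2 : 0 < ‖(z : ℂ) - 2‖ := one_pos.trans_le (hfar z)
    have h3 : 3 < ‖(z : ℂ) - 2‖ := by
      rw [div_lt_iff₀ (by positivity)] at hz
      nlinarith
    calc (analyticOrderNatAt G z : ℝ) * lorentzWeight z
        ≤ (analyticOrderNatAt G z : ℝ) * (4 / ‖(z : ℂ) - 2‖ ^ 2) := by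
          gcongr
          exact lorentzWeight_le z.2.2.1 z.2.2.2.1 h3
      _ = _ := by ring

end ZeroCounting

/-! ### Entire completions of even Dirichlet L-functions -/

section DirichletLFunctions

open Complex HurwitzZeta

variable {N : ℕ} [NeZero N]

/-- The entire function `s (1 - s) Λ(s, χ)`. -/
noncomputable def entireLFunction (χ : DirichletCharacter ℂ N) (s : ℂ) : ℂ :=
  s * (1 - s) * ZMod.completedLFunction₀ χ s - (1 - s) * ((N : ℂ) ^ (-s) * χ 0) -
    s * ((N : ℂ) ^ (-s) * ∑ j, χ j)

theorem differentiable_entireLFunction (χ : DirichletCharacter ℂ N) :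
    Differentiable ℂ (entireLFunction χ) := by
  have h1 := ZMod.differentiable_completedLFunction₀ (χ : ZMod N → ℂ)
  have h2 : Differentiable ℂ fun s : ℂ => (N : ℂ) ^ (-s) := by
    have : (N : ℂ) ≠ 0 := Nat.cast_ne_zero.mpr (NeZero.ne N)
    fun_prop (disch := simp [this])
  unfold entireLFunction
  fun_prop

theorem hasThreeHalvesGrowth_entireLFunction {χ : DirichletCharacter ℂ N} (hχ : χ.Even) :
    HasThreeHalvesGrowth (entireLFunction χ) := by
  have hN := HasThreeHalvesGrowth.natCast_cpow_neg N
  -- For an even character the odd Hurwitz contributions cancel, so the even bound suffices.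
  have hodd : ∀ s, ∑ j : ZMod N, χ j * completedHurwitzZetaOdd (ZMod.toAddCircle j) s = 0 :=
    fun s => (hχ.to_fun.mul_odd fun j => by rw [map_neg, completedHurwitzZetaOdd_neg]).sum_eq_zero
  have h0 : HasThreeHalvesGrowth (ZMod.completedLFunction₀ (χ : ZMod N → ℂ)) := by
    have h : ZMod.completedLFunction₀ (χ : ZMod N → ℂ) = fun s => (N : ℂ) ^ (-s) *
        ∑ j : ZMod N, χ j * completedHurwitzZetaEven₀ (ZMod.toAddCircle j) s := by
      ext s
      rw [ZMod.completedLFunction₀, hodd, mul_zero, add_zero]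
    rw [h]
    exact hN.mul (HasThreeHalvesGrowth.sum _ fun j => (HasThreeHalvesGrowth.const _).mul
      (hasThreeHalvesGrowth_completedHurwitzZetaEven₀ _))
  have hs := HasThreeHalvesGrowth.id
  have h1s : HasThreeHalvesGrowth fun s => 1 + (-1) * s :=
    (HasThreeHalvesGrowth.const 1).add ((HasThreeHalvesGrowth.const (-1)).mul hs)
  have h := (((hs.mul h1s).mul h0).add ((HasThreeHalvesGrowth.const (-1)).mul
    (h1s.mul (hN.mul (HasThreeHalvesGrowth.const (χ 0)))))).add
    ((HasThreeHalvesGrowth.const (-1)).mul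
      (hs.mul (hN.mul (HasThreeHalvesGrowth.const (∑ j, χ j)))))
  convert h using 2 with s
  unfold entireLFunction
  ring

theorem LFunction_eq_entireLFunction {χ : DirichletCharacter ℂ N} (hχ : χ.Even) {s : ℂ}
    (h0 : s ≠ 0) (h1 : s ≠ 1) :
    χ.LFunction s = (s * (1 - s))⁻¹ * (Gammaℝ s)⁻¹ * entireLFunction χ s := by
  have h1' : 1 - s ≠ 0 := sub_ne_zero.mpr h1.symm
  rw [DirichletCharacter.LFunction, ZMod.LFunction_eq_completed_div_gammaFactor_even hχ.to_fun s
    (.inl h0), ZMod.completedLFunction_eq, entireLFunction]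
  field_simp

theorem entireLFunction_two_ne_zero {χ : DirichletCharacter ℂ N} (hχ : χ.Even) :
    entireLFunction χ 2 ≠ 0 := by
  intro h
  have h1 := LFunction_eq_entireLFunction hχ (s := 2) two_ne_zero (by norm_num)
  rw [h, mul_zero] at h1
  exact χ.LFunction_ne_zero_of_one_le_re (.inr (by norm_num)) (by simp) h1

/-- In the strip the two functions differ by an analytic nonvanishing factor, since `1/Γ_ℝ` is
entire and has no zero with positive real part. -/
theorem analyticOrderAt_LFunction {χ : DirichletCharacter ℂ N} (hχ : χ.Even) {z : ℂ}
    (hz0 : 0 < z.re) (hz1 : z.re < 1) :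
    analyticOrderAt χ.LFunction z = analyticOrderAt (entireLFunction χ) z := by
  have h0 : z ≠ 0 := by rintro rfl; simp at hz0
  have h1 : z ≠ 1 := by rintro rfl; simp at hz1
  have h1' : 1 - z ≠ 0 := sub_ne_zero.mpr h1.symm
  set u : ℂ → ℂ := fun s => (s * (1 - s))⁻¹ * (Gammaℝ s)⁻¹ with hu
  have hua : AnalyticAt ℂ u z := by
    refine AnalyticAt.mul (AnalyticAt.inv (by fun_prop) (mul_ne_zero h0 h1')) ?_
    exact differentiable_Gammaℝ_inv.analyticAt z
  have hu0 : u z ≠ 0 := mul_ne_zero (inv_ne_zero (mul_ne_zero h0 h1'))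
    (inv_ne_zero (Gammaℝ_ne_zero_of_re_pos hz0))
  have heq : χ.LFunction =ᶠ[𝓝 z] u * entireLFunction χ := by
    filter_upwards [isOpen_ne.mem_nhds h0, isOpen_ne.mem_nhds h1] with s hs0 hs1
    exact LFunction_eq_entireLFunction hχ hs0 hs1
  rw [analyticOrderAt_congr heq,
    analyticOrderAt_mul hua ((differentiable_entireLFunction χ).analyticAt z),
    hua.analyticOrderAt_eq_zero.mpr hu0, zero_add]

/-- The identity theorem spreads finite order from the point 2. Infinite order must be excluded
because `analyticOrderNatAt` would read it as zero. -/
theorem analyticOrderAt_LFunction_ne_top {χ : DirichletCharacter ℂ N} (hχ : χ.Even) {z : ℂ}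
    (hz0 : 0 < z.re) (hz1 : z.re < 1) : analyticOrderAt χ.LFunction z ≠ ⊤ := by
  rw [analyticOrderAt_LFunction hχ hz0 hz1]
  have ha : AnalyticOnNhd ℂ (entireLFunction χ) Set.univ := fun w _ =>
    (differentiable_entireLFunction χ).analyticAt w
  refine ha.analyticOrderAt_ne_top_of_isPreconnected (x := 2) isPreconnected_univ
    (Set.mem_univ _) (Set.mem_univ _) ?_
  rw [((differentiable_entireLFunction χ).analyticAt 2).analyticOrderAt_eq_zero.mpr
    (entireLFunction_two_ne_zero hχ)]
  exact ENat.zero_ne_top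

theorem summable_lorentzWeight_LFunction {χ : DirichletCharacter ℂ N} (hχ : χ.Even) :
    Summable fun z : upperZeros χ.LFunction =>
      (analyticOrderNatAt χ.LFunction z : ℝ) * lorentzWeight z :=
  summable_lorentzWeight (differentiable_entireLFunction χ)
    (hasThreeHalvesGrowth_entireLFunction hχ) (entireLFunction_two_ne_zero hχ)
    fun _ hz => analyticOrderAt_LFunction hχ hz.2.1 hz.2.2.1

/-- `ζ` is the L-function of the even character modulo 1; the factor `s(1 - s)` already disposes of
its pole. -/
theorem summable_lorentzWeight_riemannZeta :
    Summable fun z : upperZeros riemannZeta =>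
      (analyticOrderNatAt riemannZeta z : ℝ) * lorentzWeight z := by
  have h := summable_lorentzWeight_LFunction (χ := (1 : DirichletCharacter ℂ 1))
    (by rw [DirichletCharacter.Even, Subsingleton.elim (-1 : ZMod 1) 1, map_one])
  rwa [DirichletCharacter.LFunction_modOne_eq] at h

/-- Evaluate `(Δ / (Δ - 1))`. If `d ≡ 1 mod 4`, reciprocity makes it `(-1 / d) = 1`; otherwise `Δ =
4d ≡ 1` modulo the odd number `4d - 1`. -/
theorem quadChar_even (d : ℕ) [NeZero d] : (quadChar d).Even := by
  have hd0 : 0 < d := Nat.pos_of_ne_zero (NeZero.ne d)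
  have hD : 1 ≤ fundDisc d := Nat.one_le_iff_ne_zero.mpr (NeZero.ne _)
  have h1 : (-1 : ZMod (fundDisc d)) = ((fundDisc d - 1 : ℕ) : ZMod (fundDisc d)) := by
    rw [Nat.cast_sub hD, ZMod.natCast_self, Nat.cast_one, zero_sub]
  rw [DirichletCharacter.Even, h1, quadChar_natCast]
  suffices h : kroneckerSymbol (fundDisc d) (fundDisc d - 1) = 1 by rw [h, Int.cast_one]
  by_cases h4 : d % 4 = 1
  · have hfd : fundDisc d = d := if_pos h4
    rw [hfd, kroneckerSymbol_of_mod_four_eq_one h4]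
    have h2 : ((d - 1 : ℕ) : ℤ) = -1 + d := by omega
    rw [h2, jacobiSym.mod_left, Int.add_emod_right, ← jacobiSym.mod_left,
      jacobiSym.at_neg_one (Nat.odd_iff.mpr (by omega)), ZMod.χ₄_nat_one_mod_four h4]
  · have hfd : fundDisc d = 4 * d := if_neg h4
    rw [hfd, kroneckerSymbol_of_odd _ (Nat.odd_iff.mpr (by omega)), jacobiSym.mod_left]
    have h2 : ((4 * d : ℕ) : ℤ) = 1 + ((4 * d - 1 : ℕ) : ℤ) := by omega
    have h3 : ((4 * d : ℕ) : ℤ) % ((4 * d - 1 : ℕ) : ℤ) = 1 % ((4 * d - 1 : ℕ) : ℤ) := by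
      rw [h2, Int.add_emod_right]
    rw [h3, ← jacobiSym.mod_left, jacobiSym.one_left]

end DirichletLFunctions

/-! ### Passing from the set of zeros to the enumerated list -/

section Enumeration

/-- Grouping indices by fibre turns repetition into multiplicity; absolute convergence permits the
regrouping. -/
theorem summable_comp_and_tsum_eq_of_encard_fiber {α : Type*} {e : ℕ → α} {m : α → ℕ}
    (hfib : ∀ z, {k | e k = z}.encard = m z) {φ : α → ℝ}
    (hs : Summable fun z => (m z : ℝ) * |φ z|) :
    (Summable fun k => φ (e k)) ∧ ∑' k, φ (e k) = ∑' z, (m z : ℝ) * φ z := by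
  have hfin : ∀ z, Finite {k // e k = z} := fun z =>
    Set.finite_coe_iff.mpr (Set.finite_of_encard_eq_coe (hfib z))
  have hcard : ∀ z, Nat.card {k // e k = z} = m z := fun z => by
    have h := congr_arg ENat.toNat (hfib z)
    rwa [ENat.toNat_natCast] at h
  have hfibsum : ∀ (ψ : α → ℝ) (z : α),
      ∑' k : {k // e k = z}, ψ (e k) = (m z : ℝ) * ψ z := fun ψ z => by
    rw [← hcard z]
    have : ∀ k : {k // e k = z}, ψ (e k) = ψ z := fun k => by rw [k.2]
    simp_rw [this]
    rw [tsum_const, nsmul_eq_mul]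
  have hsumm : Summable fun p : (Σ z, {k // e k = z}) => φ (e p.2) := by
    rw [← summable_abs_iff, summable_sigma_of_nonneg fun _ => abs_nonneg _]
    refine ⟨fun z => Summable.of_finite, ?_⟩
    refine hs.congr fun z => ?_
    exact (hfibsum (fun x => |φ x|) z).symm
  have hsN : Summable fun k => φ (e k) :=
    (Equiv.sigmaFiberEquiv e).summable_iff.mp hsumm
  refine ⟨hsN, ?_⟩
  rw [← (Equiv.sigmaFiberEquiv e).tsum_eq fun k => φ (e k)]
  have h := hsumm.tsum_sigma' fun z => Summable.of_finite
  simp_rw [hfibsum φ] at h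
  exact h

theorem IsZeroEnumeration.summable_and_tsum_eq {F : ℂ → ℂ} {ρ : ℕ → ℂ}
    (hρ : IsZeroEnumeration F ρ) (hF : ∀ z ∈ upperZeros F, analyticOrderAt F z ≠ ⊤)
    {φ : ℂ → ℝ}
    (hs : Summable fun z : upperZeros F => (analyticOrderNatAt F z : ℝ) * |φ z|) :
    (Summable fun k => φ (ρ k)) ∧
      ∑' k, φ (ρ k) = ∑' z : upperZeros F, (analyticOrderNatAt F z : ℝ) * φ z := by
  refine summable_comp_and_tsum_eq_of_encard_fiber
    (e := fun k => (⟨ρ k, hρ.mem k⟩ : upperZeros F)) (φ := fun z => φ z)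
    (m := fun z => analyticOrderNatAt F z) (fun z => ?_) hs
  have h := hρ.count z z.2
  rw [analyticOrderNatAt, ENat.natCast_toNat (hF z z.2), ← h]
  congr 1
  ext k
  simp [Subtype.ext_iff]

end Enumeration

/-! ### Truncation and the density bound -/

section Main

theorem abs_zeroSum_le_totalWeight {F : ℂ → ℂ}
    (hs : Summable fun z : upperZeros F => (analyticOrderNatAt F z : ℝ) * lorentzWeight z)
    (δ : ℝ) : |zeroSum F δ| ≤ totalWeight F := by
  refine tsum_of_norm_bounded (f := fun z : upperZeros F =>
    (analyticOrderNatAt F z : ℝ) * lorentzWeight z * Real.cos ((z : ℂ).im * δ)) hs.hasSum fun z => ?_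
  rw [norm_mul, Real.norm_of_nonneg (mul_nonneg (by positivity)
    (lorentzWeight_pos z.2.2.1 z.2.2.2.1).le)]
  exact mul_le_of_le_one_right (mul_nonneg (by positivity)
    (lorentzWeight_pos z.2.2.1 z.2.2.2.1).le) (Real.abs_cos_le_one _)

theorem IsZeroEnumeration.summable_lorentzWeight {F : ℂ → ℂ} {ρ : ℕ → ℂ}
    (hρ : IsZeroEnumeration F ρ) (hF : ∀ z ∈ upperZeros F, analyticOrderAt F z ≠ ⊤)
    (hs : Summable fun z : upperZeros F => (analyticOrderNatAt F z : ℝ) * lorentzWeight z) :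
    Summable fun k => lorentzWeight (ρ k) := by
  refine (hρ.summable_and_tsum_eq hF (hs.congr fun z => ?_)).1
  rw [abs_of_pos (lorentzWeight_pos z.2.2.1 z.2.2.2.1)]

/-- Once the sum is indexed by the list, the error is the tail of the series, dominated termwise by
`b_k`. -/
theorem IsZeroEnumeration.abs_zeroSum_sub_truncSum_le {F : ℂ → ℂ} {ρ : ℕ → ℂ}
    (hρ : IsZeroEnumeration F ρ) (hF : ∀ z ∈ upperZeros F, analyticOrderAt F z ≠ ⊤)
    (hs : Summable fun z : upperZeros F => (analyticOrderNatAt F z : ℝ) * lorentzWeight z)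
    (M : ℕ) (δ : ℝ) : |zeroSum F δ - truncSum ρ M δ| ≤ tailWeight ρ M := by
  have hb : ∀ z ∈ upperZeros F, |lorentzWeight z * Real.cos (z.im * δ)| ≤ lorentzWeight z := by
    intro z hz
    have h := lorentzWeight_pos hz.2.1 hz.2.2.1
    rw [abs_mul, abs_of_pos h]
    exact mul_le_of_le_one_right h.le (Real.abs_cos_le_one _)
  obtain ⟨h1, h2⟩ := hρ.summable_and_tsum_eq hF
    (φ := fun z => lorentzWeight z * Real.cos (z.im * δ))
    (Summable.of_nonneg_of_le (fun z => by positivity)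
      (fun z => mul_le_mul_of_nonneg_left (hb z z.2) (by positivity)) hs)
  have h3 : zeroSum F δ = ∑' k, lorentzWeight (ρ k) * Real.cos ((ρ k).im * δ) := by
    rw [h2, zeroSum]
    exact tsum_congr fun z => mul_assoc _ _ _
  have h4 : zeroSum F δ - truncSum ρ M δ =
      ∑' k, lorentzWeight (ρ (M + k)) * Real.cos ((ρ (M + k)).im * δ) := by
    rw [h3, truncSum, ← h1.sum_add_tsum_nat_add M, add_sub_cancel_left]
    simp only [add_comm M]
  rw [h4]
  have hsum : Summable fun k => lorentzWeight (ρ (M + k)) := by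
    simpa only [add_comm M] using
      (summable_nat_add_iff M).mpr (hρ.summable_lorentzWeight hF hs)
  rw [← Real.norm_eq_abs]
  exact tsum_of_norm_bounded hsum.hasSum fun k => hb (ρ (M + k)) (hρ.mem _)

/-- This is the only place where the arithmetic shape of `N_d` is used: its sign bounds `√d |S_L|`
by `|S_ζ|`. -/
theorem abs_truncSum_le_of_normFormEnergy_pos {d : ℕ} [NeZero d] {ρ : ℕ → ℂ}
    (hρ : IsZeroEnumeration (quadL d) ρ) (M : ℕ) {δ : ℝ} (hδ : 0 < normFormEnergy d δ) :
    |truncSum ρ M δ| ≤ totalWeight riemannZeta / √d + tailWeight ρ M := by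
  have hd : (0 : ℝ) < d := by exact_mod_cast Nat.pos_of_ne_zero (NeZero.ne d)
  have hsd : 0 < √(d : ℝ) := Real.sqrt_pos.mpr hd
  have h1 := hρ.abs_zeroSum_sub_truncSum_le
    (fun z hz => analyticOrderAt_LFunction_ne_top (quadChar_even d) hz.2.1 hz.2.2.1)
    (summable_lorentzWeight_LFunction (quadChar_even d)) M δ
  have h2 := abs_zeroSum_le_totalWeight summable_lorentzWeight_riemannZeta δ
  have h3 : |zeroSum (quadL d) δ| ≤ totalWeight riemannZeta / √d := by
    rw [le_div_iff₀ hsd]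
    refine le_trans ?_ h2
    rw [normFormEnergy] at hδ
    have h4 : (zeroSum (quadL d) δ * √d) ^ 2 ≤ zeroSum riemannZeta δ ^ 2 := by
      rw [mul_pow, Real.sq_sqrt hd.le]
      linarith
    have h5 := sq_le_sq.mp h4
    rwa [abs_mul, abs_of_pos hsd] at h5
  have h6 := abs_sub_abs_le_abs_sub (truncSum ρ M δ) (zeroSum (quadL d) δ)
  rw [abs_sub_comm] at h6
  linarith

theorem mainTheorem3 (d : ℕ) [NeZero d] (hd : 1 < d) (hsq : Squarefree d)
    (ρ : ℕ → ℂ) (hρ : IsZeroEnumeration (quadL d) ρ)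
    (M : ℕ) (hM : 3 ≤ M)
    (hindep : ∀ n : Fin M → ℤ, ∑ k, (n k : ℝ) * (ρ k).im = 0 → n = 0) :
    Summable (fun z : upperZeros riemannZeta =>
        (analyticOrderNatAt riemannZeta z : ℝ) * lorentzWeight z) ∧
    Summable (fun k => lorentzWeight (ρ k)) ∧
    IntegrableOn (fun t : ℝ => ∏ k ∈ Finset.range M, |besselJ0 (lorentzWeight (ρ k) * t)|)
        (Set.Ioi 0) ∧
    ∃ f : ℝ →ᵇ ℝ,
      IsCesaroPDF (truncSum ρ M) f ∧
      ‖f‖ ≤ (1 / Real.pi) *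
        ∫ t in Set.Ioi (0 : ℝ), ∏ k ∈ Finset.range M, |besselJ0 (lorentzWeight (ρ k) * t)| ∧
      upperCesaroDensity {δ | 0 < normFormEnergy d δ} ≤
        2 * ‖f‖ * (totalWeight riemannZeta / √d + tailWeight ρ M) ∧
      ∀ D, HasCesaroDensity {δ | 0 < normFormEnergy d δ} D →
        D ≤ 2 * ‖f‖ * (totalWeight riemannZeta / √d + tailWeight ρ M) := by
  have hw : ∀ k, 0 < lorentzWeight (ρ k) := fun k =>
    lorentzWeight_pos (hρ.mem k).2.1 (hρ.mem k).2.2.1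
  have hfin : ∀ z ∈ upperZeros (quadL d), analyticOrderAt (quadL d) z ≠ ⊤ := fun z hz =>
    analyticOrderAt_LFunction_ne_top (quadChar_even d) hz.2.1 hz.2.2.1
  have hsL := summable_lorentzWeight_LFunction (quadChar_even d)
  obtain ⟨f, hf, hfn⟩ := exists_isCesaroPDF_cosineSum hM (γ := fun k => (ρ k).im) hw hindep
  have hcont : Continuous (truncSum ρ M) := by
    unfold truncSum
    fun_prop
  have hη : 0 ≤ totalWeight riemannZeta / √d + tailWeight ρ M :=
    add_nonneg (div_nonneg ((abs_nonneg _).trans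
      (abs_zeroSum_le_totalWeight summable_lorentzWeight_riemannZeta 0)) (Real.sqrt_nonneg _))
      (tsum_nonneg fun k => (hw _).le)
  have hupper : upperCesaroDensity {δ | 0 < normFormEnergy d δ} ≤
      2 * ‖f‖ * (totalWeight riemannZeta / √d + tailWeight ρ M) :=
    upperCesaroDensity_le_of_isCesaroPDF hcont hf hη fun δ hδ =>
      abs_truncSum_le_of_normFormEnergy_pos hρ M hδ
  exact ⟨summable_lorentzWeight_riemannZeta, hρ.summable_lorentzWeight hfin hsL,
    integrableOn_prod_abs_besselJ0 hM hw, f, hf, hfn, hupper,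
    fun D hD => hD.upperCesaroDensity_eq ▸ hupper⟩

end Main
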